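/- Let $R$ be a commutative ring with unit, $G$ a group, and $\mathcal F$ a family of finite subgroups of $G$ closed under conjugation and under taking subgroups. Consider the following categories, all of which have as objects the transitive $G$-sets $G/H$ with $H\in\mathcal F$. * $\mathcal O_{\mathcal F}$ (orbit category): $[G/H,G/K]_{\mathcal O_{\mathcal F}}$ is the free abelian group on the $G$-maps $G/H\to G/K$. * $\mathcal M_{\mathcal F}$ (Mackey category): $[G/H,G/K]_{\mathcal M_{\mathcal F}}$ is the group completion of the commutative monoid (under disjoint union) of equivalence classes of diagrams of $G$-maps $G/H\leftarrow\Delta\to G/K$, where $\Delta$ is a $G$-set with finitely many orbits and stabilisers in $\mathcal F$; composition is by pullback. * $\mathcal H_{\mathcal F}$ (Hecke category): $[G/H,G/K]_{\mathcal H_{\mathcal F}}=\operatorname{Hom}_{RG}(R[G/H],R[G/K])$. Let $\sigma:\mathcal O_{\mathcal F}\to\mathcal M_{\mathcal F}$ be the identity on objects and send a $G$-map $\alpha:G/H\to G/K$ to $(G/H\xleftarrow{\mathrm{id}}G/H\xrightarrow{\alpha}G/K)$. Let $\pi:\mathcal M_{\mathcal F}\to\mathcal H_{\mathcal F}$ be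 the identity on objects and send $(G/H\xleftarrow{a}\Delta\xrightarrow{b}G/K)$ to the homomorphism $R[G/H]\to R[G/K]$, $x\mapsto\sum_{d\in a^{-1}(x)}b(d)$. An $\mathcal O_{\mathcal F}$-module is an additive contravariant functor from $\mathcal O_{\mathcal F}$ to $R$-modules, and an $\mathcal H_{\mathcal F}$-module is an $R$-linear contravariant functor from $\mathcal H_{\mathcal F}$ to $R$-modules; exactness of sequences of such modules is exactness at every object. Induction sends an $\mathcal O_{\mathcal F}$-module $M$ to the $\mathcal H_{\mathcal F}$-module $$\operatorname{Ind}_{\pi\circ\sigma}M=M(?)\otimes_{\mathcal O_{\mathcal F}}[-,\pi\sigma(?)]_{\mathcal H_{\mathcal F}},$$ where $M\otimes_{\mathcal O_{\mathcal F}}A$ is the quotient of $\bigoplus_x M(x)\otimes_R A(x)$ by the relations $\alpha^*(m)\otimes a\sim m\otimes\alpha_*(a)$. Let $\underline R$ be the constant $\mathcal O_{\mathcal F}$-module with value $R$, on which every $G$-map acts as the identity. For an $RG$-module $M$ let $M^-$ be the fixed point functor: $M^-(G/H)=M^H$, and a homomorphism $\varphi:R[G/H]\to R[G/K]$ with $\varphi(H)=\sum_g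 a_g\,gK$ acts as $M^K\to M^H$, $m\mapsto\sum_g a_g\,gm$. Let $R^-$ be the fixed point functor of the trivial $RG$-module $R$. **Proposition.** There is an isomorphism of $\mathcal H_{\mathcal F}$-modules $\theta:\operatorname{Ind}_{\pi\circ\sigma}\underline R\to R^-$ such that for every resolution $$\cdots\to P_1\to P_0\xrightarrow{\ \varepsilon\ }\underline R\to 0$$ of $\underline R$ by projective $\mathcal O_{\mathcal F}$-modules, the induced complex $$\cdots\to\operatorname{Ind}_{\pi\circ\sigma}P_1\to\operatorname{Ind}_{\pi\circ\sigma}P_0\xrightarrow{\ \theta\circ\operatorname{Ind}_{\pi\circ\sigma}(\varepsilon)\ }R^-\to 0$$ is a resolution of $R^-$ by projective $\mathcal H_{\mathcal F}$-modules. -/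

import Mathlib

open CategoryTheory Opposite TensorProduct

universe u

namespace HeckeInd

/-! ### Families of finite subgroups and transitive `G`-sets -/

/-- A family of finite subgroups of `G`, closed under conjugation and taking subgroups. -/
structure FiniteFamily (G : Type u) [Group G] where
  carrier : Set (Subgroup G)
  finite_of_mem : ∀ H ∈ carrier, Finite H
  mem_of_le : ∀ H ∈ carrier, ∀ K ≤ H, K ∈ carrier
  conj_mem : ∀ H ∈ carrier, ∀ g : G, H.map (MulAut.conj g).toMonoidHom ∈ carrier

variable {G : Type u} [Group G]

/-- The transitive `G`-sets `G ⧸ H` with `H` in the family, as objects. -/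
@[ext]
structure Orb (F : FiniteFamily G) : Type u where
  H : Subgroup G
  mem : H ∈ F.carrier

variable {F : FiniteFamily G}

/-- The underlying `G`-set `G ⧸ H`. -/
abbrev Orb.toSet (X : Orb F) : Type u := G ⧸ X.H

/-- Transitive `G`-sets with stabilisers in the family, and `G`-maps. -/
instance : Category.{u} (Orb F) where
  Hom X Y := X.toSet →[G] Y.toSet
  id X := MulActionHom.id G
  comp f g := MulActionHom.comp g f

/-- The orbit category: `[G/H, G/K]` is the free abelian group on the `G`-maps `G/H → G/K`. -/
abbrev OrbitCat (F : FiniteFamily G) : Type u := CategoryTheory.Free ℤ (Orb F)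

/-- The transitive `G`-set underlying an object of the orbit category. -/
def OrbitCat.orb (X : OrbitCat F) : Orb F := X

/-! ### The Mackey category -/

/-- A diagram of `G`-maps `X ← Δ → Y`, where `Δ` is a finitely generated `G`-set (finitely many
orbits) with stabilisers in the family. -/
structure Span (X Y : Orb F) : Type (u + 1) where
  Δ : Type u
  [act : MulAction G Δ]
  fin : Finite (MulAction.orbitRel.Quotient G Δ)
  stab : ∀ d : Δ, MulAction.stabilizer G d ∈ F.carrier
  left : Δ →[G] X.toSet
  right : Δ →[G] Y.toSet

attribute [instance] Span.act

namespace Span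

/-- Two diagrams are equivalent if there is a bijective `G`-map between the middle terms
commuting with the two legs. -/
def Equivalent {X Y : Orb F} (S T : Span X Y) : Prop :=
  ∃ e : S.Δ ≃ T.Δ, (∀ (g : G) d, e (g • d) = g • e d) ∧
    (∀ d, T.left (e d) = S.left d) ∧ (∀ d, T.right (e d) = S.right d)

instance setoid (X Y : Orb F) : Setoid (Span X Y) where
  r := Equivalent
  iseqv :=
    { refl := fun S => ⟨Equiv.refl _, fun _ _ => rfl, fun _ => rfl, fun _ => rfl⟩
      symm := by
        rintro S T ⟨e, h1, h2, h3⟩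
        refine ⟨e.symm, fun g d => ?_, fun d => ?_, fun d => ?_⟩
        · rw [Equiv.symm_apply_eq, h1, Equiv.apply_symm_apply]
        · rw [← h2, Equiv.apply_symm_apply]
        · rw [← h3, Equiv.apply_symm_apply]
      trans := by
        rintro S T U ⟨e, h1, h2, h3⟩ ⟨e', h1', h2', h3'⟩
        exact ⟨e.trans e', fun g d => by simp [h1, h1'], fun d => by simp [h2, h2'],
          fun d => by simp [h3, h3']⟩ }

/-- The action on the empty set. -/
instance emptyAction : MulAction G PEmpty.{u + 1} where
  smul _ x := x
  one_smul x := x.elim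
  mul_smul _ _ x := x.elim

/-- A `G`-set that is the union of the translates of a finite set has finitely many orbits. -/
theorem finite_orbits_of_cover {Δ ι : Type u} [MulAction G Δ] [Finite ι] (f : ι → Δ)
    (h : ∀ d, ∃ i, ∃ g : G, g • f i = d) : Finite (MulAction.orbitRel.Quotient G Δ) := by
  refine Finite.of_surjective
    (fun i => (Quotient.mk _ (f i) : MulAction.orbitRel.Quotient G Δ)) ?_
  intro q
  induction q using Quotient.inductionOn with
  | h d =>
    obtain ⟨i, g, hg⟩ := h d
    refine ⟨i, Quotient.sound ?_⟩
    exact ⟨g⁻¹, by simp [← hg]⟩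

/-- The middle term of a diagram is covered by the translates of finitely many points. -/
theorem exists_cover {X Y : Orb F} (S : Span X Y) :
    ∀ d : S.Δ, ∃ (q : MulAction.orbitRel.Quotient G S.Δ) (g : G), g • q.out = d := by
  intro d
  refine ⟨Quotient.mk _ d, ?_⟩
  have h := Quotient.mk_out (s := MulAction.orbitRel G S.Δ) d
  obtain ⟨g, hg⟩ := h
  exact ⟨g⁻¹, by rw [← hg]; simp⟩

/-- The empty diagram. -/
def empty (X Y : Orb F) : Span X Y where
  Δ := PEmpty
  fin := finite_orbits_of_cover (fun x : PEmpty => x) (fun d => d.elim)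
  stab d := d.elim
  left := ⟨fun d => d.elim, fun _ d => d.elim⟩
  right := ⟨fun d => d.elim, fun _ d => d.elim⟩

/-- The disjoint union of two diagrams. -/
def add {X Y : Orb F} (S T : Span X Y) : Span X Y where
  Δ := S.Δ ⊕ T.Δ
  fin := by
    have := S.fin
    have := T.fin
    refine finite_orbits_of_cover
      (Sum.map (fun q : MulAction.orbitRel.Quotient G S.Δ => q.out)
        (fun q : MulAction.orbitRel.Quotient G T.Δ => q.out)) ?_
    rintro (d | d)
    · obtain ⟨q, g, h⟩ := S.exists_cover d
      exact ⟨Sum.inl q, g, by simp [h]⟩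
    · obtain ⟨q, g, h⟩ := T.exists_cover d
      exact ⟨Sum.inr q, g, by simp [h]⟩
  stab := by
    rintro (d | d)
    · convert S.stab d using 1
      ext g; simp [MulAction.mem_stabilizer_iff]
    · convert T.stab d using 1
      ext g; simp [MulAction.mem_stabilizer_iff]
  left := ⟨Sum.elim S.left T.left, by rintro g (d | d) <;> simp⟩
  right := ⟨Sum.elim S.right T.right, by rintro g (d | d) <;> simp⟩

/-- Only finitely many group elements move one given point of `G/K` to another. -/
theorem finite_transporter (X : Orb F) (x y : X.toSet) : Finite {g : G // g • x = y} := by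
  have := F.finite_of_mem _ X.mem
  obtain ⟨a, rfl⟩ := QuotientGroup.mk_surjective x
  obtain ⟨b, rfl⟩ := QuotientGroup.mk_surjective y
  refine Finite.of_injective
    (fun g : {g : G // g • (a : G ⧸ X.H) = (b : G ⧸ X.H)} =>
      (⟨b⁻¹ * (g.1 * a), QuotientGroup.eq.mp g.2.symm⟩ : X.H)) ?_
  intro g g' h
  have h' := congrArg Subtype.val h
  exact Subtype.ext (by simpa using h')

/-- The pullback of the inner legs of two composable diagrams. -/
abbrev Pullback {X Y Z : Orb F} (S : Span X Y) (T : Span Y Z) : Type u :=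
  {p : S.Δ × T.Δ // S.right p.1 = T.left p.2}

instance pullbackAction {X Y Z : Orb F} (S : Span X Y) (T : Span Y Z) :
    MulAction G (Pullback S T) where
  smul g p := ⟨g • p.1, by simp [p.2]⟩
  one_smul p := Subtype.ext (one_smul G p.1)
  mul_smul g g' p := Subtype.ext (mul_smul g g' p.1)

/-- The composite of two composable diagrams, with middle term the pullback. -/
def comp {X Y Z : Orb F} (S : Span X Y) (T : Span Y Z) : Span X Z where
  Δ := Pullback S T
  fin := by
    have := S.fin
    have := T.fin
    have : ∀ (q : MulAction.orbitRel.Quotient G S.Δ × MulAction.orbitRel.Quotient G T.Δ),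
        Finite {g : G // g • T.left q.2.out = S.right q.1.out} :=
      fun q => finite_transporter Y _ _
    refine finite_orbits_of_cover
      (ι := Σ q : MulAction.orbitRel.Quotient G S.Δ × MulAction.orbitRel.Quotient G T.Δ,
        {g : G // g • T.left q.2.out = S.right q.1.out})
      (fun i => ⟨(i.1.1.out, i.2.1 • i.1.2.out), by simp [i.2.2]⟩) ?_
    rintro ⟨⟨d, e⟩, h⟩
    obtain ⟨q, g, rfl⟩ := S.exists_cover d
    obtain ⟨q', g', rfl⟩ := T.exists_cover e
    refine ⟨⟨(q, q'), ⟨g⁻¹ * g', ?_⟩⟩, g, ?_⟩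
    · simp only [map_smul] at h
      rw [mul_smul, ← h, inv_smul_smul]
    · refine Subtype.ext (Prod.ext rfl ?_)
      change g • (g⁻¹ * g') • q'.out = g' • q'.out
      rw [mul_smul, smul_inv_smul]
  stab := by
    rintro ⟨⟨d, e⟩, h⟩
    refine F.mem_of_le _ (S.stab d) _ ?_
    intro g hg
    exact congrArg (fun p => p.1.1) hg
  left := ⟨fun p => S.left p.1.1, fun g p => map_smul S.left g p.1.1⟩
  right := ⟨fun p => T.right p.1.2, fun g p => map_smul T.right g p.1.2⟩

/-- The diagram `X ← X → Y` of a `G`-map, with the identity as left leg. -/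
def ofMap {X Y : Orb F} (f : X.toSet →[G] Y.toSet) : Span X Y where
  Δ := X.toSet
  fin := finite_orbits_of_cover (ι := PUnit) (fun _ => ((1 : G) : G ⧸ X.H)) (by
    intro d
    obtain ⟨a, rfl⟩ := QuotientGroup.mk_surjective d
    exact ⟨PUnit.unit, a, by simp⟩)
  stab := by
    intro d
    obtain ⟨a, rfl⟩ := QuotientGroup.mk_surjective d
    convert F.conj_mem _ X.mem a using 1
    rw [show ((a : G) : G ⧸ X.H) = a • ((1 : G) : G ⧸ X.H) by simp,
      MulAction.stabilizer_smul_eq_stabilizer_map_conj]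
    congr 1
    exact MulAction.stabilizer_quotient X.H
  left := MulActionHom.id G
  right := f

/-- The fibres of the left leg are finite. -/
theorem finite_fibre {X Y : Orb F} (S : Span X Y) (x : X.toSet) : {d | S.left d = x}.Finite := by
  have := S.fin
  have : ∀ q : MulAction.orbitRel.Quotient G S.Δ, Finite {g : G // g • S.left q.out = x} :=
    fun q => finite_transporter X _ _
  refine Set.Finite.subset (Set.finite_range
    (fun i : Σ q : MulAction.orbitRel.Quotient G S.Δ, {g : G // g • S.left q.out = x} =>
      i.2.1 • i.1.out)) ?_
  intro d hd
  obtain ⟨q, g, rfl⟩ := S.exists_cover d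
  exact ⟨⟨q, g, by simpa using hd⟩, rfl⟩

end Span

/-- The commutative monoid of equivalence classes of diagrams `X ← Δ → Y` under disjoint union. -/
def SpanClass (X Y : Orb F) : Type (u + 1) := Quotient (Span.setoid X Y)

namespace SpanClass

/-- The class of a diagram. -/
def mk {X Y : Orb F} (S : Span X Y) : SpanClass X Y := Quotient.mk _ S

theorem mk_eq {X Y : Orb F} {S T : Span X Y} (h : S.Equivalent T) : mk S = mk T :=
  Quotient.sound h

instance (X Y : Orb F) : Zero (SpanClass X Y) := ⟨mk (Span.empty X Y)⟩

instance (X Y : Orb F) : Add (SpanClass X Y) :=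
  ⟨Quotient.map₂ Span.add (by
    rintro S S' ⟨e, h1, h2, h3⟩ T T' ⟨e', h1', h2', h3'⟩
    refine ⟨Equiv.sumCongr e e', ?_, ?_, ?_⟩
    · rintro g (d | d)
      · exact congrArg Sum.inl (h1 g d)
      · exact congrArg Sum.inr (h1' g d)
    · rintro (d | d)
      · exact h2 d
      · exact h2' d
    · rintro (d | d)
      · exact h3 d
      · exact h3' d)⟩

theorem mk_add {X Y : Orb F} (S T : Span X Y) : mk S + mk T = mk (S.add T) := rfl

theorem mk_zero (X Y : Orb F) : (0 : SpanClass X Y) = mk (Span.empty X Y) := rfl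

instance (X Y : Orb F) : AddCommMonoid (SpanClass X Y) where
  add_assoc := by
    rintro ⟨S⟩ ⟨T⟩ ⟨U⟩
    refine mk_eq ⟨Equiv.sumAssoc S.Δ T.Δ U.Δ, ?_, ?_, ?_⟩
    · rintro g ((d | d) | d) <;> rfl
    · rintro ((d | d) | d) <;> rfl
    · rintro ((d | d) | d) <;> rfl
  zero_add := by
    rintro ⟨S⟩
    refine mk_eq ⟨Equiv.emptySum PEmpty S.Δ, ?_, ?_, ?_⟩
    · rintro g (d | d)
      · exact d.elim
      · rfl
    · rintro (d | d)
      · exact d.elim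
      · rfl
    · rintro (d | d)
      · exact d.elim
      · rfl
  add_zero := by
    rintro ⟨S⟩
    refine mk_eq ⟨Equiv.sumEmpty S.Δ PEmpty, ?_, ?_, ?_⟩
    · rintro g (d | d)
      · rfl
      · exact d.elim
    · rintro (d | d)
      · rfl
      · exact d.elim
    · rintro (d | d)
      · rfl
      · exact d.elim
  add_comm := by
    rintro ⟨S⟩ ⟨T⟩
    refine mk_eq ⟨Equiv.sumComm S.Δ T.Δ, ?_, ?_, ?_⟩
    · rintro g (d | d) <;> rfl
    · rintro (d | d) <;> rfl
    · rintro (d | d) <;> rfl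
  nsmul := nsmulRec

/-- Composition of classes of diagrams by pullback. -/
def comp {X Y Z : Orb F} : SpanClass X Y → SpanClass Y Z → SpanClass X Z :=
  Quotient.map₂ Span.comp (by
    rintro S S' ⟨e, h1, h2, h3⟩ T T' ⟨e', h1', h2', h3'⟩
    refine ⟨(Equiv.prodCongr e e').subtypeEquiv ?_, ?_, ?_, ?_⟩
    · rintro ⟨d, d'⟩
      simp [h3, h2']
    · rintro g ⟨⟨d, d'⟩, h⟩
      exact Subtype.ext (Prod.ext (h1 g d) (h1' g d'))
    · rintro ⟨⟨d, d'⟩, h⟩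
      exact h2 d
    · rintro ⟨⟨d, d'⟩, h⟩
      exact h3' d')

theorem mk_comp {X Y Z : Orb F} (S : Span X Y) (T : Span Y Z) :
    comp (mk S) (mk T) = mk (S.comp T) := rfl

theorem zero_comp {X Y Z : Orb F} (b : SpanClass Y Z) : comp (0 : SpanClass X Y) b = 0 := by
  obtain ⟨T⟩ := b
  have : IsEmpty ((Span.empty X Y).comp T).Δ := ⟨fun p => p.1.1.elim⟩
  exact mk_eq ⟨Equiv.equivPEmpty _, fun _ p => p.1.1.elim, fun p => p.1.1.elim,
    fun p => p.1.1.elim⟩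

theorem comp_zero {X Y Z : Orb F} (a : SpanClass X Y) : comp a (0 : SpanClass Y Z) = 0 := by
  obtain ⟨S⟩ := a
  have : IsEmpty (S.comp (Span.empty Y Z)).Δ := ⟨fun p => p.1.2.elim⟩
  exact mk_eq ⟨Equiv.equivPEmpty _, fun _ p => p.1.2.elim, fun p => p.1.2.elim,
    fun p => p.1.2.elim⟩

theorem add_comp {X Y Z : Orb F} (a a' : SpanClass X Y) (b : SpanClass Y Z) :
    comp (a + a') b = comp a b + comp a' b := by
  obtain ⟨S⟩ := a
  obtain ⟨S'⟩ := a'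
  obtain ⟨T⟩ := b
  refine mk_eq ⟨
    { toFun := fun p => match p with
        | ⟨(Sum.inl d, t), h⟩ => Sum.inl ⟨(d, t), h⟩
        | ⟨(Sum.inr d, t), h⟩ => Sum.inr ⟨(d, t), h⟩
      invFun := fun p => match p with
        | Sum.inl p => ⟨(Sum.inl p.1.1, p.1.2), p.2⟩
        | Sum.inr p => ⟨(Sum.inr p.1.1, p.1.2), p.2⟩
      left_inv := by rintro ⟨⟨d | d, t⟩, h⟩ <;> rfl
      right_inv := by rintro (p | p) <;> rfl }, ?_, ?_, ?_⟩
  · rintro g ⟨⟨d | d, t⟩, h⟩ <;> rfl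
  · rintro ⟨⟨d | d, t⟩, h⟩ <;> rfl
  · rintro ⟨⟨d | d, t⟩, h⟩ <;> rfl

theorem comp_add {X Y Z : Orb F} (a : SpanClass X Y) (b b' : SpanClass Y Z) :
    comp a (b + b') = comp a b + comp a b' := by
  obtain ⟨S⟩ := a
  obtain ⟨T⟩ := b
  obtain ⟨T'⟩ := b'
  refine mk_eq ⟨
    { toFun := fun p => match p with
        | ⟨(d, Sum.inl t), h⟩ => Sum.inl ⟨(d, t), h⟩
        | ⟨(d, Sum.inr t), h⟩ => Sum.inr ⟨(d, t), h⟩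
      invFun := fun p => match p with
        | Sum.inl p => ⟨(p.1.1, Sum.inl p.1.2), p.2⟩
        | Sum.inr p => ⟨(p.1.1, Sum.inr p.1.2), p.2⟩
      left_inv := by rintro ⟨⟨d, t | t⟩, h⟩ <;> rfl
      right_inv := by rintro (p | p) <;> rfl }, ?_, ?_, ?_⟩
  · rintro g ⟨⟨d, t | t⟩, h⟩ <;> rfl
  · rintro ⟨⟨d, t | t⟩, h⟩ <;> rfl
  · rintro ⟨⟨d, t | t⟩, h⟩ <;> rfl

theorem comp_assoc {W X Y Z : Orb F} (a : SpanClass W X) (b : SpanClass X Y)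
    (c : SpanClass Y Z) : comp (comp a b) c = comp a (comp b c) := by
  obtain ⟨S⟩ := a
  obtain ⟨T⟩ := b
  obtain ⟨U⟩ := c
  refine mk_eq ⟨
    { toFun := fun p => ⟨(p.1.1.1.1, ⟨(p.1.1.1.2, p.1.2), p.2⟩), p.1.1.2⟩
      invFun := fun p => ⟨(⟨(p.1.1, p.1.2.1.1), p.2⟩, p.1.2.1.2), p.1.2.2⟩
      left_inv := fun _ => rfl
      right_inv := fun _ => rfl }, fun _ _ => rfl, fun _ => rfl, fun _ => rfl⟩

theorem id_comp {X Y : Orb F} (a : SpanClass X Y) : comp (mk (Span.ofMap (X := X) (MulActionHom.id G))) a = a := by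
  obtain ⟨S⟩ := a
  exact mk_eq ⟨
    { toFun := fun p => p.1.2
      invFun := fun d => ⟨(S.left d, d), rfl⟩
      left_inv := fun p => Subtype.ext (Prod.ext p.2.symm rfl)
      right_inv := fun _ => rfl }, fun _ _ => rfl, fun p => p.2.symm, fun _ => rfl⟩

theorem comp_id {X Y : Orb F} (a : SpanClass X Y) : comp a (mk (Span.ofMap (X := Y) (MulActionHom.id G))) = a := by
  obtain ⟨S⟩ := a
  exact mk_eq ⟨
    { toFun := fun p => p.1.1
      invFun := fun d => ⟨(d, S.right d), rfl⟩
      left_inv := fun p => Subtype.ext (Prod.ext rfl p.2)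
      right_inv := fun _ => rfl }, fun _ _ => rfl, fun _ => rfl, fun p => p.2⟩

theorem ofMap_comp {X Y Z : Orb F} (f : X.toSet →[G] Y.toSet) (g : Y.toSet →[G] Z.toSet) :
    comp (mk (Span.ofMap f)) (mk (Span.ofMap g)) = mk (Span.ofMap (g.comp f)) :=
  mk_eq ⟨
    { toFun := fun p => p.1.1
      invFun := fun x => ⟨(x, f x), rfl⟩
      left_inv := fun p => Subtype.ext (Prod.ext rfl p.2)
      right_inv := fun _ => rfl },
    fun _ _ => rfl, fun _ => rfl, fun p => congrArg g p.2⟩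

/-- Composition of classes as a biadditive map. -/
def compHom (X Y Z : Orb F) : SpanClass X Y →+ SpanClass Y Z →+ SpanClass X Z where
  toFun a :=
    { toFun := comp a
      map_zero' := comp_zero a
      map_add' := comp_add a }
  map_zero' := AddMonoidHom.ext zero_comp
  map_add' a a' := AddMonoidHom.ext (add_comp a a')

end SpanClass

open Algebra (GrothendieckAddGroup)

/-- The Mackey category. Its objects are those of the orbit category. -/
structure MackeyCat (F : FiniteFamily G) : Type u where
  orb : Orb F

namespace MackeyCat

/-- The morphisms: the group completion of the monoid of classes of diagrams. -/
abbrev Mor (X Y : Orb F) : Type (u + 1) := GrothendieckAddGroup (SpanClass X Y)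

/-- The basic morphism given by a diagram. -/
noncomputable def basic {X Y : Orb F} (S : Span X Y) : Mor X Y :=
  GrothendieckAddGroup.of (SpanClass.mk S)

theorem lift_of {M A : Type*} [AddCommMonoid M] [AddCommGroup A] (f : M →+ A) (x : M) :
    GrothendieckAddGroup.lift f (GrothendieckAddGroup.of x) = f x :=
  DFunLike.congr_fun (GrothendieckAddGroup.lift.symm_apply_apply f) x

theorem completion_ind {M : Type*} [AddCommMonoid M] {p : GrothendieckAddGroup M → Prop}
    (of : ∀ x, p (GrothendieckAddGroup.of x)) (sub : ∀ a b, p a → p b → p (a - b))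
    (a : GrothendieckAddGroup M) : p a := by
  induction a using AddLocalization.ind with
  | H y =>
    obtain ⟨m, s⟩ := y
    have h : AddLocalization.mk m s =
        GrothendieckAddGroup.of m - GrothendieckAddGroup.of (s : M) := by
      simp only [GrothendieckAddGroup.of, AddSubmonoid.LocalizationMap.toAddMonoidHom_apply,
        ← AddLocalization.mk_zero_eq_addMonoidOf_mk, GrothendieckAddGroup.mk_sub_mk]
      simp
    rw [h]
    exact sub _ _ (of _) (of _)

/-- The universal property of the group completion, as an additive map. -/
noncomputable def liftHom (M A : Type*) [AddCommMonoid M] [AddCommGroup A] :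
    (M →+ A) →+ (GrothendieckAddGroup M →+ A) where
  toFun f := GrothendieckAddGroup.lift f
  map_zero' := by
    ext a
    induction a using completion_ind with
    | of x => simp only [lift_of]; rfl
    | sub a b ha hb => rw [map_sub, ha, hb, map_sub]
  map_add' f g := by
    ext a
    induction a using completion_ind with
    | of x => simp only [lift_of, AddMonoidHom.add_apply]
    | sub a b ha hb => rw [map_sub, ha, hb, map_sub]

/-- The biadditive extension of the composition of diagrams. -/
noncomputable def compHom (X Y Z : Orb F) : Mor X Y →+ Mor Y Z →+ Mor X Z :=
  GrothendieckAddGroup.lift ((liftHom _ _).comp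
    ((AddMonoidHom.compHom GrothendieckAddGroup.of).comp (SpanClass.compHom X Y Z)))

theorem compHom_of {X Y Z : Orb F} (a : SpanClass X Y) (b : SpanClass Y Z) :
    compHom X Y Z (GrothendieckAddGroup.of a) (GrothendieckAddGroup.of b) =
      GrothendieckAddGroup.of (SpanClass.comp a b) := by
  rw [compHom, lift_of]
  exact lift_of _ _

theorem compHom_basic {X Y Z : Orb F} (S : Span X Y) (T : Span Y Z) :
    compHom X Y Z (basic S) (basic T) = basic (S.comp T) :=
  compHom_of _ _

noncomputable instance : Category.{u + 1} (MackeyCat F) where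
  Hom X Y := Mor X.orb Y.orb
  id X := basic (Span.ofMap (MulActionHom.id G))
  comp f g := compHom _ _ _ f g
  id_comp f := by
    induction f using completion_ind with
    | of x => rw [basic, compHom_of, SpanClass.id_comp]
    | sub a b ha hb => rw [map_sub, ha, hb]
  comp_id f := by
    induction f using completion_ind with
    | of x => rw [basic, compHom_of, SpanClass.comp_id]
    | sub a b ha hb => rw [map_sub, AddMonoidHom.sub_apply, ha, hb]
  assoc f g h := by
    induction f using completion_ind with
    | sub a b ha hb => simp only [map_sub, AddMonoidHom.sub_apply, ha, hb]
    | of x =>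
      induction g using completion_ind with
      | sub a b ha hb => simp only [map_sub, AddMonoidHom.sub_apply, ha, hb]
      | of y =>
        induction h using completion_ind with
        | sub a b ha hb => simp only [map_sub, ha, hb]
        | of z => simp only [compHom_of, SpanClass.comp_assoc]

noncomputable instance : Preadditive (MackeyCat F) where
  homGroup X Y := inferInstanceAs (AddCommGroup (Mor X.orb Y.orb))
  add_comp X Y Z f f' g :=
    DFunLike.congr_fun (AddMonoidHom.map_add (compHom X.orb Y.orb Z.orb) f f') g
  comp_add X Y Z f g g' := AddMonoidHom.map_add (compHom X.orb Y.orb Z.orb f) g g'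

end MackeyCat

/-- The functor `σ` on morphisms, which sends a `G`-map `α : G/H → G/K` to the basic morphism
`G/H ← G/H → G/K` with legs `id` and `α`. -/
noncomputable def sigmaHom (X Y : Orb F) :
    ((X.toSet →[G] Y.toSet) →₀ ℤ) →+ MackeyCat.Mor X Y :=
  Finsupp.liftAddHom (fun α => zmultiplesHom _ (MackeyCat.basic (Span.ofMap α)))

theorem sigmaHom_single (X Y : Orb F) (α : X.toSet →[G] Y.toSet) (n : ℤ) :
    sigmaHom X Y (Finsupp.single α n) = n • MackeyCat.basic (Span.ofMap α) := by
  simp [sigmaHom]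

theorem sigmaHom_comp {X Y Z : Orb F} (f : (X.toSet →[G] Y.toSet) →₀ ℤ)
    (g : (Y.toSet →[G] Z.toSet) →₀ ℤ) :
    sigmaHom X Z (f.sum fun α n => g.sum fun β m => Finsupp.single (β.comp α) (n * m)) =
      MackeyCat.compHom X Y Z (sigmaHom X Y f) (sigmaHom Y Z g) := by
  induction f using Finsupp.induction_linear with
  | zero => simp
  | add f f' hf hf' =>
    rw [Finsupp.sum_add_index', map_add, hf, hf', map_add, map_add, AddMonoidHom.add_apply]
    · simp
    · intro α n n'
      rw [← Finsupp.sum_add]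
      simp [add_mul]
  | single α n =>
    rw [Finsupp.sum_single_index (by simp)]
    induction g using Finsupp.induction_linear with
    | zero => simp
    | add g g' hg hg' =>
      rw [Finsupp.sum_add_index', map_add, hg, hg', map_add, map_add]
      · simp
      · simp [mul_add]
    | single β m =>
      rw [Finsupp.sum_single_index (by simp), sigmaHom_single, sigmaHom_single, sigmaHom_single,
        map_zsmul, map_zsmul, AddMonoidHom.smul_apply, MackeyCat.compHom_basic, smul_smul,
        mul_comm]
      exact congrArg (fun c => (m * n) • GrothendieckAddGroup.of c) (SpanClass.ofMap_comp α β).symm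

/-- The functor `σ` from the orbit category to the Mackey category. -/
noncomputable def sigma (F : FiniteFamily G) : OrbitCat F ⥤ MackeyCat F where
  obj X := ⟨X.orb⟩
  map {X Y} f := sigmaHom X.orb Y.orb f
  map_id X := (sigmaHom_single X.orb X.orb _ 1).trans (one_zsmul _)
  map_comp f g := sigmaHom_comp f g

instance : (sigma F).Additive where
  map_add {X Y f g} := AddMonoidHom.map_add (sigmaHom X.orb Y.orb) f g

/-! ### The Hecke category -/

variable (R : Type u) [CommRing R]

/-- The permutation module `R[G/H]`. -/
noncomputable abbrev permRep (X : Orb F) : Rep.{u} R G :=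
  Rep.of (Representation.ofMulAction R G X.toSet)

/-- The Hecke category. Its objects are those of the orbit category. -/
structure HeckeCat (R : Type u) [CommRing R] (F : FiniteFamily G) : Type u where
  orb : Orb F

/-- The morphisms from `G/H` to `G/K` in the Hecke category are the `RG`-module homomorphisms
`R[G/H] → R[G/K]`. -/
noncomputable instance : Category.{u} (HeckeCat R F) :=
  inferInstanceAs (Category (InducedCategory (Rep.{u} R G) fun X : HeckeCat R F => permRep R X.orb))

noncomputable instance : Preadditive (HeckeCat R F) :=
  inferInstanceAs
    (Preadditive (InducedCategory (Rep.{u} R G) fun X : HeckeCat R F => permRep R X.orb))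

noncomputable instance : Linear R (HeckeCat R F) :=
  inferInstanceAs
    (Linear R (InducedCategory (Rep.{u} R G) fun X : HeckeCat R F => permRep R X.orb))

variable {R}

/-- The linear map on the free module `R[S]` extending a function on `S`. -/
noncomputable def extend {S V : Type*} [AddCommGroup V] [Module R V] (f : S → V) :
    MonoidAlgebra R S →ₗ[R] V :=
  (Finsupp.linearCombination R f).comp (MonoidAlgebra.coeffLinearEquiv R).toLinearMap

@[simp]
theorem extend_single {S V : Type*} [AddCommGroup V] [Module R V] (f : S → V) (s : S) (r : R) :
    extend f (MonoidAlgebra.single s r) = r • f s := by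
  simp [extend]

theorem perm_ext {S V : Type*} [AddCommGroup V] [Module R V] {f g : MonoidAlgebra R S →ₗ[R] V}
    (h : ∀ s, f (MonoidAlgebra.single s 1) = g (MonoidAlgebra.single s 1)) : f = g := by
  apply MonoidAlgebra.lhom_ext'
  intro s
  ext
  exact h s

variable (R)

/-- The `R`-linear map `R[X] → R[Y]` attached to a diagram `X ← Δ → Y`: a point `x` goes to the
sum of the right-hand images of the points of `Δ` over `x`. -/
noncomputable def Span.linear {X Y : Orb F} (S : Span X Y) :
    MonoidAlgebra R X.toSet →ₗ[R] MonoidAlgebra R Y.toSet :=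
  extend fun x => ∑ d ∈ (S.finite_fibre x).toFinset, MonoidAlgebra.single (S.right d) 1

theorem Span.linear_single {X Y : Orb F} (S : Span X Y) (x : X.toSet) :
    S.linear R (MonoidAlgebra.single x 1) =
      ∑ d ∈ (S.finite_fibre x).toFinset, MonoidAlgebra.single (S.right d) 1 := by
  rw [Span.linear, extend_single, one_smul]

/-- The fibre may be indexed by any finite set that is in bijection with it. -/
theorem Span.linear_of_index {X Y : Orb F} (S : Span X Y) (x : X.toSet) {I : Type*} (t : Finset I)
    (f : I → S.Δ) (inj : Set.InjOn f t) (mem : ∀ i ∈ t, S.left (f i) = x)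
    (surj : ∀ d, S.left d = x → ∃ i ∈ t, f i = d) :
    S.linear R (MonoidAlgebra.single x 1) =
      ∑ i ∈ t, MonoidAlgebra.single (S.right (f i)) 1 := by
  rw [Span.linear_single]
  symm
  refine Finset.sum_bij (fun i _ => f i) ?_ ?_ ?_ ?_
  · intro i hi
    simpa using mem i hi
  · intro i hi j hj h
    exact inj hi hj h
  · intro d hd
    obtain ⟨i, hi, h⟩ := surj d (by simpa using hd)
    exact ⟨i, hi, h⟩
  · intro i _
    rfl

theorem Span.linear_smul {X Y : Orb F} (S : Span X Y) (g : G) :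
    S.linear R ∘ₗ Representation.ofMulAction R G X.toSet g =
      Representation.ofMulAction R G Y.toSet g ∘ₗ S.linear R := by
  apply perm_ext
  intro x
  rw [LinearMap.comp_apply, LinearMap.comp_apply, Representation.ofMulAction_single,
    S.linear_of_index R (g • x) (S.finite_fibre x).toFinset (fun d => g • d), S.linear_single R,
    map_sum]
  · simp
  · intro d _ e _ h
    exact smul_left_cancel g h
  · intro d hd
    simpa using hd
  · intro d hd
    exact ⟨g⁻¹ • d, by simp [hd], smul_inv_smul g d⟩

theorem Span.linear_eq {X Y : Orb F} {S T : Span X Y} (h : S.Equivalent T) :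
    S.linear R = T.linear R := by
  obtain ⟨e, -, h2, h3⟩ := h
  apply perm_ext
  intro x
  rw [T.linear_of_index R x (S.finite_fibre x).toFinset e, S.linear_single R]
  · simp [h3]
  · exact e.injective.injOn
  · intro d hd
    simpa [h2] using hd
  · intro d hd
    exact ⟨e.symm d, by simp [← h2, hd], e.apply_symm_apply d⟩

theorem Span.linear_add {X Y : Orb F} (S T : Span X Y) :
    (S.add T).linear R = S.linear R + T.linear R := by
  apply perm_ext
  intro x
  rw [LinearMap.add_apply, S.linear_single R, T.linear_single R,
    (S.add T).linear_of_index R x ((S.finite_fibre x).toFinset.disjSum (T.finite_fibre x).toFinset)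
      (fun d => d) Function.injective_id.injOn, Finset.sum_disjSum]
  · rfl
  · rintro (d | d) hd
    · exact (S.finite_fibre x).mem_toFinset.mp (Finset.inl_mem_disjSum.mp hd)
    · exact (T.finite_fibre x).mem_toFinset.mp (Finset.inr_mem_disjSum.mp hd)
  · rintro (d | d) hd
    · exact ⟨Sum.inl d, Finset.inl_mem_disjSum.mpr ((S.finite_fibre x).mem_toFinset.mpr hd), rfl⟩
    · exact ⟨Sum.inr d, Finset.inr_mem_disjSum.mpr ((T.finite_fibre x).mem_toFinset.mpr hd), rfl⟩

theorem Span.linear_empty (X Y : Orb F) : (Span.empty X Y).linear R = 0 := by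
  apply perm_ext
  intro x
  rw [(Span.empty X Y).linear_of_index R x (∅ : Finset PEmpty.{1}) (fun d => d.elim)]
  · simp
  · intro d
    exact d.elim
  · intro d
    exact d.elim
  · intro d
    exact PEmpty.elim d

theorem Span.linear_comp {X Y Z : Orb F} (S : Span X Y) (T : Span Y Z) :
    (S.comp T).linear R = T.linear R ∘ₗ S.linear R := by
  classical
  apply perm_ext
  intro x
  rw [LinearMap.comp_apply, S.linear_single R, map_sum]
  simp only [T.linear_single R]
  rw [Finset.sum_sigma', ← Finset.sum_attach]
  rw [(S.comp T).linear_of_index R x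
    ((S.finite_fibre x).toFinset.sigma fun d => (T.finite_fibre (S.right d)).toFinset).attach
    (fun q => ⟨(q.1.1, q.1.2), by
    have := q.2
    simp only [Finset.mem_sigma, Set.Finite.mem_toFinset, Set.mem_ofPred_eq] at this
    exact this.2.symm⟩)]
  · rfl
  · rintro ⟨⟨d, e⟩, h⟩ _ ⟨⟨d', e'⟩, h'⟩ _ hh
    have h1 := congrArg (fun p : Span.Pullback S T => p.1.1) hh
    have h2 := congrArg (fun p : Span.Pullback S T => p.1.2) hh
    simp only at h1 h2
    subst h1 h2
    rfl
  · rintro ⟨⟨d, e⟩, h⟩ _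
    simp only [Finset.mem_sigma, Set.Finite.mem_toFinset, Set.mem_ofPred_eq] at h
    exact h.1
  · rintro ⟨⟨d, e⟩, h⟩ hd
    refine ⟨⟨⟨d, e⟩, ?_⟩, Finset.mem_attach _ _, rfl⟩
    simp only [Finset.mem_sigma, Set.Finite.mem_toFinset, Set.mem_ofPred_eq]
    exact ⟨hd, h.symm⟩

/-- A `G`-map `α` goes to the `R`-linear extension of `α`. -/
theorem Span.linear_ofMap {X Y : Orb F} (α : X.toSet →[G] Y.toSet) (x : X.toSet) :
    (Span.ofMap α).linear R (MonoidAlgebra.single x 1) = MonoidAlgebra.single (α x) 1 := by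
  rw [(Span.ofMap α).linear_of_index R x ({x} : Finset X.toSet) (fun d => d)
    Function.injective_id.injOn, Finset.sum_singleton]
  · rfl
  · intro d hd
    exact Finset.mem_singleton.mp hd
  · intro d hd
    exact ⟨d, Finset.mem_singleton.mpr hd, rfl⟩

/-- The morphism of the Hecke category attached to a diagram. -/
noncomputable def Span.hecke {X Y : Orb F} (S : Span X Y) : (⟨X⟩ : HeckeCat R F) ⟶ ⟨Y⟩ :=
  InducedCategory.homMk (Rep.ofHom ⟨S.linear R, S.linear_smul R⟩)

theorem hecke_ext {X Y : HeckeCat R F} {f g : X ⟶ Y}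
    (h : f.hom.hom.toLinearMap = g.hom.hom.toLinearMap) : f = g :=
  InducedCategory.hom_ext (Rep.hom_ext (Representation.IntertwiningMap.ext h))

/-- The functor `π` on morphisms. -/
noncomputable def piHom (X Y : Orb F) :
    MackeyCat.Mor X Y →+ ((⟨X⟩ : HeckeCat R F) ⟶ ⟨Y⟩) :=
  GrothendieckAddGroup.lift
    { toFun := Quotient.lift (fun S => S.hecke R) (fun _ _ h => hecke_ext R (Span.linear_eq R h))
      map_zero' := hecke_ext R (Span.linear_empty R X Y)
      map_add' := by
        rintro ⟨S⟩ ⟨T⟩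
        exact hecke_ext R (Span.linear_add R S T) }

theorem piHom_basic {X Y : Orb F} (S : Span X Y) :
    piHom R X Y (MackeyCat.basic S) = S.hecke R :=
  MackeyCat.lift_of _ _

theorem piHom_comp {X Y Z : Orb F} (f : MackeyCat.Mor X Y) (g : MackeyCat.Mor Y Z) :
    piHom R X Z (MackeyCat.compHom X Y Z f g) = piHom R X Y f ≫ piHom R Y Z g := by
  induction f using MackeyCat.completion_ind with
  | sub a b ha hb =>
    rw [map_sub, AddMonoidHom.sub_apply, map_sub, ha, hb, map_sub, Preadditive.sub_comp]
  | of s =>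
    induction g using MackeyCat.completion_ind with
    | sub a b ha hb => rw [map_sub, map_sub, ha, hb, map_sub, Preadditive.comp_sub]
    | of t =>
      induction s using Quotient.inductionOn with
      | h S =>
        induction t using Quotient.inductionOn with
        | h T =>
          refine (congrArg _ (MackeyCat.compHom_basic S T)).trans ((piHom_basic R _).trans ?_)
          refine Eq.trans ?_ (congrArg₂ (· ≫ ·) (piHom_basic R S) (piHom_basic R T)).symm
          exact hecke_ext R (Span.linear_comp R S T)

/-- The functor `π` from the Mackey category to the Hecke category: the identity on objects, and
a basic morphism `X ← Δ → Y` goes to the `RG`-homomorphism `R[X] → R[Y]` that sends `x` to the sum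
of the right-hand images of the points of `Δ` over `x`. -/
noncomputable def pi (F : FiniteFamily G) : MackeyCat F ⥤ HeckeCat R F where
  obj X := ⟨X.orb⟩
  map {X Y} f := piHom R X.orb Y.orb f
  map_id _ := (piHom_basic R _).trans
    (hecke_ext R (perm_ext fun x => Span.linear_ofMap R (MulActionHom.id G) x))
  map_comp f g := piHom_comp R f g

instance : (pi R F).Additive where
  map_add {X Y f g} := AddMonoidHom.map_add (piHom R X.orb Y.orb) f g

/-- The composite `σ ⋙ π` sends a `G`-map to its `R`-linear extension. -/
theorem sigma_pi_map_single {X Y : OrbitCat F} (α : X.orb.toSet →[G] Y.orb.toSet)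
    (x : X.orb.toSet) :
    ((sigma F ⋙ pi R F).map (Finsupp.single α (1 : ℤ) : X ⟶ Y)).hom.hom
        (MonoidAlgebra.single x 1) = MonoidAlgebra.single (α x) 1 := by
  have h : (sigma F ⋙ pi R F).map (Finsupp.single α (1 : ℤ) : X ⟶ Y) =
      (Span.ofMap α).hecke R := by
    refine (congrArg (piHom R X.orb Y.orb) (sigmaHom_single X.orb Y.orb α 1)).trans ?_
    rw [one_zsmul, piHom_basic]
  rw [h]
  exact Span.linear_ofMap R α x

/-! ### Modules over a category -/

section Modules

variable (C : Type u) [Category.{u} C] [Preadditive C]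

/-- Additive contravariant functors to `R`-modules. -/
def isAdditive : ObjectProperty (Cᵒᵖ ⥤ ModuleCat.{u} R) := fun M => M.Additive

/-- Contravariant modules over `R` over a preadditive category: additive contravariant functors
to `R`-modules. -/
abbrev AddMod := (isAdditive R C).FullSubcategory

/-- `R`-linear contravariant functors to `R`-modules. -/
def isLinear [Linear R C] : ObjectProperty (Cᵒᵖ ⥤ ModuleCat.{u} R) := fun M =>
  M.Additive ∧ ∀ (x y : C) (r : R) (f : x ⟶ y), M.map (r • f).op = r • M.map f.op

/-- Contravariant modules over an `R`-linear category: `R`-linear contravariant functors to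
`R`-modules. -/
abbrev LinMod [Linear R C] := (isLinear R C).FullSubcategory

end Modules

/-- A projective resolution: `P` is a chain complex of projective objects in a category of
contravariant modules, and `⋯ → P 1 → P 0 → M → 0` is exact at every object `x`. -/
structure IsProjectiveResolution {R : Type u} [CommRing R] {C : Type u} [Category.{u} C]
    {W : ObjectProperty (Cᵒᵖ ⥤ ModuleCat.{u} R)} (P : ChainComplex W.FullSubcategory ℕ)
    {M : W.FullSubcategory} (ε : P.X 0 ⟶ M) : Prop where
  projective : ∀ n, Projective (P.X n)
  surjective : ∀ x, Function.Surjective (ε.hom.app x)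
  exact_zero : ∀ x, Function.Exact ((P.d 1 0).hom.app x) (ε.hom.app x)
  exact_succ : ∀ n x,
    Function.Exact ((P.d (n + 2) (n + 1)).hom.app x) ((P.d (n + 1) n).hom.app x)

/-! ### Tensor products over a category -/

section Tensor

variable {R} {C : Type u} [Category.{u} C]

/-- The direct sum of the `M(x) ⊗ A(x)` over all objects `x`. -/
abbrev TensorSum (M : Cᵒᵖ ⥤ ModuleCat.{u} R) (A : C ⥤ ModuleCat.{u} R) : Type u :=
  DirectSum C fun x => (M.obj (op x)) ⊗[R] (A.obj x)

open Classical in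
/-- The elementary tensor `m ⊗ a` in the summand at `x`. -/
noncomputable def elemTensor (M : Cᵒᵖ ⥤ ModuleCat.{u} R) (A : C ⥤ ModuleCat.{u} R) (x : C)
    (m : M.obj (op x)) (a : A.obj x) : TensorSum M A :=
  DirectSum.lof R C (fun x => (M.obj (op x)) ⊗[R] (A.obj x)) x (m ⊗ₜ a)

/-- The relations `α^*(m) ⊗ a ∼ m ⊗ α_*(a)` for `α : x ⟶ y`. -/
def tensorRel (M : Cᵒᵖ ⥤ ModuleCat.{u} R) (A : C ⥤ ModuleCat.{u} R) :
    Submodule R (TensorSum M A) :=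
  Submodule.span R {t | ∃ (x y : C) (α : x ⟶ y) (m : M.obj (op y)) (a : A.obj x),
    t = elemTensor M A x (M.map α.op m) a - elemTensor M A y m (A.map α a)}

/-- The tensor product `M ⊗ A` over the category `C`. -/
abbrev CatTensor (M : Cᵒᵖ ⥤ ModuleCat.{u} R) (A : C ⥤ ModuleCat.{u} R) : Type u :=
  TensorSum M A ⧸ tensorRel M A

/-- The class of the elementary tensor `m ⊗ a` with `m ∈ M(x)` and `a ∈ A(x)`. -/
noncomputable def ctmul (M : Cᵒᵖ ⥤ ModuleCat.{u} R) (A : C ⥤ ModuleCat.{u} R) (x : C)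
    (m : M.obj (op x)) (a : A.obj x) : CatTensor M A :=
  (tensorRel M A).mkQ (elemTensor M A x m a)

theorem catTensor_ext {M : Cᵒᵖ ⥤ ModuleCat.{u} R} {A : C ⥤ ModuleCat.{u} R} {V : Type*}
    [AddCommGroup V] [Module R V] {f g : CatTensor M A →ₗ[R] V}
    (h : ∀ x m a, f (ctmul M A x m a) = g (ctmul M A x m a)) : f = g := by
  classical
  apply Submodule.linearMap_qext
  apply DirectSum.linearMap_ext
  intro x
  apply TensorProduct.ext'
  intro m a
  exact h x m a

open Classical in
/-- The linear map out of a direct sum of tensor products given by bilinear maps. -/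
noncomputable def sumLift {M : Cᵒᵖ ⥤ ModuleCat.{u} R} {A : C ⥤ ModuleCat.{u} R} {V : Type*}
    [AddCommGroup V] [Module R V] (φ : ∀ x, M.obj (op x) →ₗ[R] A.obj x →ₗ[R] V) :
    TensorSum M A →ₗ[R] V :=
  DirectSum.toModule R C V fun x => TensorProduct.lift (φ x)

theorem sumLift_elemTensor {M : Cᵒᵖ ⥤ ModuleCat.{u} R} {A : C ⥤ ModuleCat.{u} R} {V : Type*}
    [AddCommGroup V] [Module R V] (φ : ∀ x, M.obj (op x) →ₗ[R] A.obj x →ₗ[R] V) (x : C)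
    (m : M.obj (op x)) (a : A.obj x) : sumLift φ (elemTensor M A x m a) = φ x m a := by
  classical
  rw [sumLift, elemTensor, DirectSum.toModule_lof, TensorProduct.lift.tmul]

/-- The linear map out of `M ⊗ A` given by a balanced family of bilinear maps. -/
noncomputable def ctlift {M : Cᵒᵖ ⥤ ModuleCat.{u} R} {A : C ⥤ ModuleCat.{u} R} {V : Type*}
    [AddCommGroup V] [Module R V] (φ : ∀ x, M.obj (op x) →ₗ[R] A.obj x →ₗ[R] V)
    (h : ∀ (x y : C) (α : x ⟶ y) (m : M.obj (op y)) (a : A.obj x),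
      φ x (M.map α.op m) a = φ y m (A.map α a)) : CatTensor M A →ₗ[R] V :=
  (tensorRel M A).liftQ (sumLift φ) (by
    rw [tensorRel, Submodule.span_le]
    rintro _ ⟨x, y, α, m, a, rfl⟩
    rw [SetLike.mem_coe, LinearMap.mem_ker, map_sub, sumLift_elemTensor, sumLift_elemTensor, h, sub_self])

theorem ctlift_ctmul {M : Cᵒᵖ ⥤ ModuleCat.{u} R} {A : C ⥤ ModuleCat.{u} R} {V : Type*}
    [AddCommGroup V] [Module R V] (φ : ∀ x, M.obj (op x) →ₗ[R] A.obj x →ₗ[R] V)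
    (h : ∀ (x y : C) (α : x ⟶ y) (m : M.obj (op y)) (a : A.obj x),
      φ x (M.map α.op m) a = φ y m (A.map α a)) (x : C) (m : M.obj (op x)) (a : A.obj x) :
    ctlift φ h (ctmul M A x m a) = φ x m a :=
  sumLift_elemTensor φ x m a

open Classical in
/-- The class of an elementary tensor, as a bilinear map. -/
noncomputable def ctmulHom (M : Cᵒᵖ ⥤ ModuleCat.{u} R) (A : C ⥤ ModuleCat.{u} R) (x : C) :
    M.obj (op x) →ₗ[R] A.obj x →ₗ[R] CatTensor M A :=
  (TensorProduct.mk R (M.obj (op x)) (A.obj x)).compr₂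
    ((tensorRel M A).mkQ ∘ₗ DirectSum.lof R C (fun x => (M.obj (op x)) ⊗[R] (A.obj x)) x)

theorem ctmulHom_apply (M : Cᵒᵖ ⥤ ModuleCat.{u} R) (A : C ⥤ ModuleCat.{u} R) (x : C)
    (m : M.obj (op x)) (a : A.obj x) : ctmulHom M A x m a = ctmul M A x m a := rfl

theorem ctmul_map (M : Cᵒᵖ ⥤ ModuleCat.{u} R) (A : C ⥤ ModuleCat.{u} R) {x y : C} (α : x ⟶ y)
    (m : M.obj (op y)) (a : A.obj x) :
    ctmul M A x (M.map α.op m) a = ctmul M A y m (A.map α a) := by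
  rw [ctmul, ctmul, ← sub_eq_zero, ← map_sub, Submodule.mkQ_apply, Submodule.Quotient.mk_eq_zero]
  exact Submodule.subset_span ⟨x, y, α, m, a, rfl⟩

/-- The map `M ⊗ A → M' ⊗ A'` induced by natural transformations, `m ⊗ a ↦ f(m) ⊗ g(a)`. -/
noncomputable def ctmap {M M' : Cᵒᵖ ⥤ ModuleCat.{u} R} {A A' : C ⥤ ModuleCat.{u} R}
    (f : M ⟶ M') (g : A ⟶ A') : CatTensor M A →ₗ[R] CatTensor M' A' :=
  ctlift (fun x => (ctmulHom M' A' x).compl₁₂ (f.app (op x)).hom (g.app x).hom) (by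
    intro x y α m a
    simp only [LinearMap.compl₁₂_apply, ctmulHom_apply]
    have h1 : (f.app (op x)).hom (M.map α.op m) = M'.map α.op (f.app (op y) m) :=
      ConcreteCategory.congr_hom (f.naturality α.op) m
    have h2 : (g.app y).hom (A.map α a) = A'.map α (g.app x a) :=
      ConcreteCategory.congr_hom (g.naturality α) a
    rw [h1, h2]
    exact ctmul_map M' A' α _ _)

theorem ctmap_ctmul {M M' : Cᵒᵖ ⥤ ModuleCat.{u} R} {A A' : C ⥤ ModuleCat.{u} R}
    (f : M ⟶ M') (g : A ⟶ A') (x : C) (m : M.obj (op x)) (a : A.obj x) :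
    ctmap f g (ctmul M A x m a) = ctmul M' A' x (f.app (op x) m) (g.app x a) :=
  ctlift_ctmul _ _ x m a

theorem ctmap_id (M : Cᵒᵖ ⥤ ModuleCat.{u} R) (A : C ⥤ ModuleCat.{u} R) :
    ctmap (𝟙 M) (𝟙 A) = LinearMap.id :=
  catTensor_ext fun x m a => ctmap_ctmul _ _ x m a

theorem ctmap_comp {M M' M'' : Cᵒᵖ ⥤ ModuleCat.{u} R} {A A' A'' : C ⥤ ModuleCat.{u} R}
    (f : M ⟶ M') (f' : M' ⟶ M'') (g : A ⟶ A') (g' : A' ⟶ A'') :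
    ctmap (f ≫ f') (g ≫ g') = ctmap f' g' ∘ₗ ctmap f g := by
  apply catTensor_ext
  intro x m a
  rw [LinearMap.comp_apply, ctmap_ctmul, ctmap_ctmul, ctmap_ctmul]
  rfl

theorem ctmap_add_left {M M' : Cᵒᵖ ⥤ ModuleCat.{u} R} {A A' : C ⥤ ModuleCat.{u} R}
    (f f' : M ⟶ M') (g : A ⟶ A') : ctmap (f + f') g = ctmap f g + ctmap f' g := by
  apply catTensor_ext
  intro x m a
  rw [LinearMap.add_apply, ctmap_ctmul, ctmap_ctmul, ctmap_ctmul]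
  exact LinearMap.map_add₂ (ctmulHom M' A' x) _ _ _

theorem ctmap_add_right {M M' : Cᵒᵖ ⥤ ModuleCat.{u} R} {A A' : C ⥤ ModuleCat.{u} R}
    (f : M ⟶ M') (g g' : A ⟶ A') : ctmap f (g + g') = ctmap f g + ctmap f g' := by
  apply catTensor_ext
  intro x m a
  rw [LinearMap.add_apply, ctmap_ctmul, ctmap_ctmul, ctmap_ctmul]
  exact map_add (ctmulHom M' A' x _) _ _

theorem ctmap_smul_right {M M' : Cᵒᵖ ⥤ ModuleCat.{u} R} {A A' : C ⥤ ModuleCat.{u} R}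
    (f : M ⟶ M') (r : R) (g : A ⟶ A') : ctmap f (r • g) = r • ctmap f g := by
  apply catTensor_ext
  intro x m a
  rw [LinearMap.smul_apply, ctmap_ctmul, ctmap_ctmul]
  exact map_smul (ctmulHom M' A' x _) _ _

end Tensor

/-! ### Induction -/

section Induction

variable {C D : Type u} [Category.{u} C] [Category.{u} D] [Preadditive D] [Linear R D] (ι : C ⥤ D)

/-- For an object `d` of `D`, the covariant functor `R[d, ι(?)]` on `C`. -/
noncomputable def homFrom : Dᵒᵖ ⥤ C ⥤ ModuleCat.{u} R :=
  linearCoyoneda R D ⋙ (Functor.whiskeringLeft C D (ModuleCat.{u} R)).obj ι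

theorem homFrom_map_add {d e : D} (f g : d ⟶ e) :
    (homFrom R ι).map (f + g).op = (homFrom R ι).map f.op + (homFrom R ι).map g.op := by
  apply NatTrans.ext
  funext x
  apply ModuleCat.hom_ext
  apply LinearMap.ext
  intro a
  exact Preadditive.add_comp _ _ _ f g a

theorem homFrom_map_smul {d e : D} (r : R) (f : d ⟶ e) :
    (homFrom R ι).map (r • f).op = r • (homFrom R ι).map f.op := by
  apply NatTrans.ext
  funext x
  apply ModuleCat.hom_ext
  apply LinearMap.ext
  intro a
  exact Linear.smul_comp _ _ _ r f a

/-- The functor `M(?) ⊗ R[-, ι(?)]` on `D`, the tensor product being taken over `C`. -/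
noncomputable def indObj (M : Cᵒᵖ ⥤ ModuleCat.{u} R) : Dᵒᵖ ⥤ ModuleCat.{u} R where
  obj d := ModuleCat.of R (CatTensor M ((homFrom R ι).obj d))
  map h := ModuleCat.ofHom (ctmap (𝟙 M) ((homFrom R ι).map h))
  map_id d := by
    rw [CategoryTheory.Functor.map_id, ctmap_id]
    rfl
  map_comp h k := by
    rw [CategoryTheory.Functor.map_comp, ← ModuleCat.ofHom_comp, ← ctmap_comp, Category.comp_id]

theorem indObj_linear (M : Cᵒᵖ ⥤ ModuleCat.{u} R) : isLinear R D (indObj R ι M) := by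
  refine ⟨⟨?_⟩, ?_⟩
  · intro d e f g
    apply ModuleCat.hom_ext
    change ctmap (𝟙 M) ((homFrom R ι).map (f.unop + g.unop).op) = _
    rw [homFrom_map_add, ctmap_add_right]
    rfl
  · intro d e r f
    apply ModuleCat.hom_ext
    change ctmap (𝟙 M) ((homFrom R ι).map (r • f).op) = _
    rw [homFrom_map_smul, ctmap_smul_right]
    rfl

variable [Preadditive C]

/-- Induction along `ι : C ⥤ D`, from contravariant `C`-modules to contravariant `D`-modules:
`M ↦ M(?) ⊗ R[-, ι(?)]`. -/
noncomputable def ind : AddMod R C ⥤ LinMod R D where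
  obj M := ⟨indObj R ι M.obj, indObj_linear R ι M.obj⟩
  map f := ObjectProperty.homMk
    { app := fun d => ModuleCat.ofHom (ctmap f.hom (𝟙 ((homFrom R ι).obj d)))
      naturality := fun d e h => by
        change ModuleCat.ofHom _ ≫ ModuleCat.ofHom _ = ModuleCat.ofHom _ ≫ ModuleCat.ofHom _
        rw [← ModuleCat.ofHom_comp, ← ModuleCat.ofHom_comp, ← ctmap_comp, ← ctmap_comp,
          Category.id_comp, Category.id_comp, Category.comp_id, Category.comp_id] }
  map_id M := by
    apply ObjectProperty.hom_ext
    apply NatTrans.ext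
    funext d
    exact congrArg ModuleCat.ofHom (ctmap_id M.obj ((homFrom R ι).obj d))
  map_comp f g := by
    apply ObjectProperty.hom_ext
    apply NatTrans.ext
    funext d
    refine (congrArg ModuleCat.ofHom ?_).trans (ModuleCat.ofHom_comp _ _)
    rw [← ctmap_comp, Category.comp_id]
    rfl

instance : (ind R ι).Additive where
  map_add {M N f g} := by
    apply ObjectProperty.hom_ext
    apply NatTrans.ext
    funext d
    exact congrArg ModuleCat.ofHom (ctmap_add_left f.hom g.hom (𝟙 ((homFrom R ι).obj d)))

end Induction

/-! ### The constant module and the fixed point functors -/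

/-- The sum of the coefficients of a `ℤ`-linear combination. -/
noncomputable def coeffSum (S : Type u) : (S →₀ ℤ) →+ ℤ :=
  Finsupp.liftAddHom fun _ => AddMonoidHom.id ℤ

theorem coeffSum_single {S : Type u} (s : S) (n : ℤ) : coeffSum S (Finsupp.single s n) = n := by
  simp [coeffSum]

theorem coeffSum_comp {X Y Z : Orb F} (f : (X.toSet →[G] Y.toSet) →₀ ℤ)
    (g : (Y.toSet →[G] Z.toSet) →₀ ℤ) :
    coeffSum _ (f.sum fun α n => g.sum fun β m => Finsupp.single (β.comp α) (n * m)) =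
      coeffSum _ f * coeffSum _ g := by
  induction f using Finsupp.induction_linear with
  | zero => simp
  | add f f' hf hf' =>
    rw [Finsupp.sum_add_index', map_add, hf, hf', map_add, add_mul]
    · simp
    · intro α n n'
      rw [← Finsupp.sum_add]
      simp [add_mul]
  | single α n =>
    rw [Finsupp.sum_single_index (by simp)]
    induction g using Finsupp.induction_linear with
    | zero => simp
    | add g g' hg hg' =>
      rw [Finsupp.sum_add_index', map_add, hg, hg', map_add, mul_add]
      · simp
      · simp [mul_add]
    | single β m =>
      rw [Finsupp.sum_single_index (by simp), coeffSum_single, coeffSum_single, coeffSum_single]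

/-- The constant module `R` over the orbit category: every object goes to `R`, and every `G`-map
goes to the identity, so a `ℤ`-linear combination of `G`-maps goes to multiplication by the sum of
its coefficients. -/
noncomputable def constantFunctor (F : FiniteFamily G) :
    (OrbitCat F)ᵒᵖ ⥤ ModuleCat.{u} R where
  obj _ := ModuleCat.of R R
  map f := coeffSum _ f.unop • 𝟙 (ModuleCat.of R R)
  map_id X := (congrArg (· • 𝟙 (ModuleCat.of R R)) (coeffSum_single _ 1)).trans (one_smul ℤ _)
  map_comp f g := by
    refine (congrArg (· • 𝟙 (ModuleCat.of R R)) (coeffSum_comp g.unop f.unop)).trans ?_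
    rw [Preadditive.zsmul_comp, Preadditive.comp_zsmul, Category.comp_id, smul_smul]
    exact congrArg (· • 𝟙 (ModuleCat.of R R)) (mul_comm _ _)

/-- The constant contravariant module `R` over the orbit category. -/
noncomputable def constantModule (F : FiniteFamily G) : AddMod R (OrbitCat F) where
  obj := constantFunctor R F
  property := ⟨fun {_ _ f g} =>
    (congrArg (· • 𝟙 (ModuleCat.of R R))
      (AddMonoidHom.map_add (coeffSum _) f.unop g.unop)).trans (add_smul _ _ _)⟩

/-- The submodule of elements fixed by `H`. -/
def fixedBy (M : Rep.{u} R G) (H : Subgroup G) : Submodule R M.V where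
  carrier := {m | ∀ h ∈ H, M.ρ h m = m}
  add_mem' ha hb h hh := by rw [map_add, ha h hh, hb h hh]
  zero_mem' h _ := map_zero _
  smul_mem' r m hm h hh := by rw [map_smul, hm h hh]

variable {R}

/-- For `m` fixed by `H`, the map `G/H → M` sending `gH` to `g m`. -/
def orbitMap {M : Rep.{u} R G} {H : Subgroup G} (m : fixedBy R M H) : G ⧸ H → M.V :=
  Quotient.lift (fun g => M.ρ g m.1) (by
    intro a b hab
    have h := m.2 _ (QuotientGroup.leftRel_apply.mp hab)
    have h' := congrArg (M.ρ a) h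
    rw [← Module.End.mul_apply, ← map_mul, mul_inv_cancel_left] at h'
    exact h'.symm)

/-- The element `∑ a_g (g m)` for an element `∑ a_g gH` of `R[G/H]` and `m` fixed by `H`. -/
noncomputable def orbitLin {M : Rep.{u} R G} {H : Subgroup G} (m : fixedBy R M H) :
    MonoidAlgebra R (G ⧸ H) →ₗ[R] M.V :=
  extend (orbitMap m)

theorem orbitLin_single_one {M : Rep.{u} R G} {H : Subgroup G} (m : fixedBy R M H) :
    orbitLin m (MonoidAlgebra.single ((1 : G) : G ⧸ H) 1) = m.1 := by
  rw [orbitLin, extend_single, one_smul]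
  change M.ρ 1 m.1 = m.1
  simp

theorem orbitLin_smul {M : Rep.{u} R G} {H : Subgroup G} (m : fixedBy R M H) (g : G)
    (v : MonoidAlgebra R (G ⧸ H)) :
    orbitLin m (Representation.ofMulAction R G (G ⧸ H) g v) = M.ρ g (orbitLin m v) := by
  have h : orbitLin m ∘ₗ Representation.ofMulAction R G (G ⧸ H) g = M.ρ g ∘ₗ orbitLin m := by
    apply perm_ext
    intro q
    obtain ⟨a, rfl⟩ := QuotientGroup.mk_surjective q
    simp only [LinearMap.comp_apply, Representation.ofMulAction_single, orbitLin, extend_single,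
      one_smul]
    change M.ρ (g * a) m.1 = M.ρ g (M.ρ a m.1)
    rw [map_mul, Module.End.mul_apply]
  exact LinearMap.congr_fun h v

/-- An equivariant map out of `R[G/H]` is determined by its value at the coset `H`. -/
theorem eq_orbitLin {M : Rep.{u} R G} {H : Subgroup G} (m : fixedBy R M H)
    (φ : MonoidAlgebra R (G ⧸ H) →ₗ[R] M.V)
    (hφ : ∀ g v, φ (Representation.ofMulAction R G (G ⧸ H) g v) = M.ρ g (φ v))
    (h : φ (MonoidAlgebra.single ((1 : G) : G ⧸ H) 1) = m.1) : φ = orbitLin m := by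
  apply perm_ext
  intro q
  obtain ⟨a, rfl⟩ := QuotientGroup.mk_surjective q
  have h1 : MonoidAlgebra.single ((a : G) : G ⧸ H) (1 : R) =
      Representation.ofMulAction R G (G ⧸ H) a (MonoidAlgebra.single ((1 : G) : G ⧸ H) 1) := by
    rw [Representation.ofMulAction_single]
    simp
  rw [h1, hφ, orbitLin_smul, h, orbitLin_single_one]

theorem orbitLin_add {M : Rep.{u} R G} {H : Subgroup G} (m m' : fixedBy R M H) :
    orbitLin (m + m') = orbitLin m + orbitLin m' := by
  symm
  apply eq_orbitLin
  · intro g v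
    simp only [LinearMap.add_apply, orbitLin_smul, map_add]
  · simp only [LinearMap.add_apply, orbitLin_single_one, Submodule.coe_add]

theorem orbitLin_const_smul {M : Rep.{u} R G} {H : Subgroup G} (r : R) (m : fixedBy R M H) :
    orbitLin (r • m) = r • orbitLin m := by
  symm
  apply eq_orbitLin
  · intro g v
    simp only [LinearMap.smul_apply, orbitLin_smul, map_smul]
  · simp only [LinearMap.smul_apply, orbitLin_single_one, Submodule.coe_smul]

/-- The coset `H` as an element of `R[G/H]`. -/
noncomputable def baseCoset (R : Type u) [CommRing R] (X : Orb F) : MonoidAlgebra R X.toSet :=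
  MonoidAlgebra.single ((1 : G) : G ⧸ X.H) 1

theorem baseCoset_fixed (X : Orb F) (h : G) (hh : h ∈ X.H) :
    Representation.ofMulAction R G X.toSet h (baseCoset R X) = baseCoset R X := by
  rw [baseCoset, Representation.ofMulAction_single]
  congr 1
  rw [MulAction.Quotient.smul_coe]
  exact QuotientGroup.eq.mpr (by simpa using hh)

/-- For an `RG`-homomorphism `φ : R[G/H] → R[G/K]` with `φ(H) = ∑ a_g gK`, the map `M^K → M^H`,
`m ↦ ∑ a_g (g m)`. -/
noncomputable def fixedMap (M : Rep.{u} R G) {X Y : HeckeCat R F} (φ : X ⟶ Y) :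
    fixedBy R M Y.orb.H →ₗ[R] fixedBy R M X.orb.H where
  toFun m := ⟨orbitLin m (φ.hom.hom (baseCoset R X.orb)), by
    intro h hh
    rw [← orbitLin_smul]
    refine congrArg (orbitLin m) ?_
    refine (Rep.hom_comm_apply φ.hom h _).symm.trans ?_
    exact congrArg φ.hom.hom (baseCoset_fixed X.orb h hh)⟩
  map_add' m m' := Subtype.ext (LinearMap.congr_fun (orbitLin_add m m') _)
  map_smul' r m := Subtype.ext (LinearMap.congr_fun (orbitLin_const_smul r m) _)

theorem fixedMap_coe (M : Rep.{u} R G) {X Y : HeckeCat R F} (φ : X ⟶ Y)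
    (m : fixedBy R M Y.orb.H) :
    (fixedMap M φ m).1 = orbitLin m (φ.hom.hom (baseCoset R X.orb)) := rfl

theorem orbitLin_fixedMap (M : Rep.{u} R G) {X Y : HeckeCat R F} (φ : X ⟶ Y)
    (m : fixedBy R M Y.orb.H) :
    orbitLin (fixedMap M φ m) = orbitLin m ∘ₗ φ.hom.hom.toLinearMap := by
  symm
  apply eq_orbitLin
  · intro g v
    rw [LinearMap.comp_apply, LinearMap.comp_apply, ← orbitLin_smul]
    exact congrArg (orbitLin m) (Rep.hom_comm_apply φ.hom g v)
  · rfl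

/-- The fixed point functor `G/H ↦ M^H` of an `RG`-module `M`, as a contravariant module over the
Hecke category. In particular `M^-(G/K → G/H)` is the inclusion `M^H → M^K` for `K ≤ H`, the
transfer from `K` to `H` goes to the trace `m ↦ ∑_{h ∈ H/K} h m`, and the conjugation
`gK' ↦ g x K` by `x` goes to `m ↦ x m`. -/
noncomputable def fixedPointFunctor (F : FiniteFamily G) (M : Rep.{u} R G) :
    (HeckeCat R F)ᵒᵖ ⥤ ModuleCat.{u} R where
  obj X := ModuleCat.of R (fixedBy R M X.unop.orb.H)
  map φ := ModuleCat.ofHom (fixedMap M φ.unop)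
  map_id X := by
    apply ModuleCat.hom_ext
    apply LinearMap.ext
    intro m
    exact Subtype.ext (orbitLin_single_one m)
  map_comp φ ψ := by
    apply ModuleCat.hom_ext
    apply LinearMap.ext
    intro m
    exact Subtype.ext (LinearMap.congr_fun (orbitLin_fixedMap M φ.unop m) _).symm

/-- The fixed point functor `M^-` as a contravariant module over the Hecke category. -/
noncomputable def fixedPointModule (F : FiniteFamily G) (M : Rep.{u} R G) :
    LinMod R (HeckeCat R F) where
  obj := fixedPointFunctor F M
  property := by
    refine ⟨⟨?_⟩, ?_⟩
    · intro X Y f g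
      apply ModuleCat.hom_ext
      apply LinearMap.ext
      intro m
      exact Subtype.ext (map_add (orbitLin m) _ _)
    · intro X Y r f
      apply ModuleCat.hom_ext
      apply LinearMap.ext
      intro m
      exact Subtype.ext (map_smul (orbitLin m) r _)

end HeckeInd

namespace HeckeInd

section

variable {G : Type u} [Group G] {F : FiniteFamily G}

/-! ### Products of transitive `G`-sets -/

/-! Exactness is checked at one object `X` at a time, where the induced module is `M ⊗ [X, ?]` with
the homs taken in the Hecke category. The module `R[X] → R[Y]` of Hecke morphisms is free on the
orbits `w` of `X × Y`: the basis element of `w` is the transfer along `w → X` followed by the push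
along `w → Y` (`orbitBasis`). Hence every tensor is a sum of terms `m ⊗ b_* tr(a)` with legs `a : Z
→ X` and `b : Z → Y`, and such a term equals `b^* m ⊗ tr(a)`, which lives over the object `a` of the
slice category over `X`. Sending the one to the other gives a map `toSlice` to a tensor product over
the slice, natural in `M` and split by the canonical map `ofSlice` (`ofSlice_toSlice`). It is well
defined because pushing `tr(a ∘ p)` along `p` gives a multiple of `tr(a)`, the factor being the size
of the fibres of `p` (`exists_transfer_comp`).

So it is enough that the resolution becomes contractible, as a complex of functors, after
restriction to the slice: a contraction survives any tensor product and passes to the retract. Two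
facts give the contraction. The slice has the terminal object `id_X`, so a surjection onto the
constant module splits there (`exists_slice_section`). And restrictions of projectives still have
the lifting property (`exists_slice_lift`): a `G`-map `s → Y` from an object `s` over `X` is the
same as an orbit `w` of `X × Y` and a map `s → w` over `X`, so the restriction of a representable
module is a direct sum of representables.

For the constant module itself, `1 ⊗ φ = deg(φ) (1 ⊗ id_X)`, with `deg` the augmentation of the
image of the base coset; this identifies its value at `X` with `R`, and multiplicativity of `deg`
makes the identification natural (`indConstantIso`). Induction preserves projectives because it is
left adjoint to restriction, which preserves epimorphisms (`projective_ind`). -/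

theorem stabilizer_mem (X : Orb F) (x : X.toSet) : MulAction.stabilizer G x ∈ F.carrier :=
  (Span.ofMap (X := X) (MulActionHom.id G)).stab x

/-- The orbits of the product of two transitive `G`-sets. -/
abbrev ProdOrbit (X Y : Orb F) : Type u := MulAction.orbitRel.Quotient G (X.toSet × Y.toSet)

/-- The transitive `G`-set attached to an orbit in a product. -/
noncomputable def orbitObj {X Y : Orb F} (w : ProdOrbit X Y) : Orb F where
  H := MulAction.stabilizer G w.out
  mem := by
    refine F.mem_of_le _ (stabilizer_mem X w.out.1) _ ?_
    intro g hg
    exact congrArg Prod.fst hg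

/-- The inclusion of an orbit in a product. -/
noncomputable def orbitIncl {X Y : Orb F} (w : ProdOrbit X Y) :
    (orbitObj w).toSet →[G] X.toSet × Y.toSet where
  toFun := MulAction.ofQuotientStabilizer G w.out
  map_smul' := MulAction.ofQuotientStabilizer_smul G w.out

theorem orbitIncl_injective {X Y : Orb F} (w : ProdOrbit X Y) :
    Function.Injective (orbitIncl w) :=
  MulAction.injective_ofQuotientStabilizer G w.out

/-- Turns questions about the range of `orbitIncl w` into equalities of classes in the orbit
quotient; the forward direction separates orbits, the backward one produces factorisations. -/
theorem exists_orbitIncl_eq_iff {X Y : Orb F} (w : ProdOrbit X Y) (p : X.toSet × Y.toSet) :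
    (∃ z, orbitIncl w z = p) ↔ (Quotient.mk _ p : ProdOrbit X Y) = w := by
  constructor
  · rintro ⟨z, rfl⟩
    obtain ⟨g, rfl⟩ := QuotientGroup.mk_surjective z
    conv_rhs => rw [← Quotient.out_eq w]
    exact Quotient.sound ⟨g, rfl⟩
  · rintro rfl
    obtain ⟨g, hg⟩ := Quotient.mk_out (s := MulAction.orbitRel G (X.toSet × Y.toSet)) p
    refine ⟨((g⁻¹ : G) : G ⧸ _), ?_⟩
    change g⁻¹ • Quotient.out _ = p
    rw [← hg, inv_smul_smul]

theorem mk_orbitIncl {X Y : Orb F} (w : ProdOrbit X Y) (z) :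
    (Quotient.mk _ (orbitIncl w z) : ProdOrbit X Y) = w :=
  (exists_orbitIncl_eq_iff w _).mp ⟨z, rfl⟩

/-- The projection of an orbit in `X × Y` to `X`. -/
noncomputable def orbitFst {X Y : Orb F} (w : ProdOrbit X Y) :
    (orbitObj w).toSet →[G] X.toSet :=
  (MulActionHom.fst G X.toSet Y.toSet).comp (orbitIncl w)

/-- The projection of an orbit in `X × Y` to `Y`. -/
noncomputable def orbitSnd {X Y : Orb F} (w : ProdOrbit X Y) :
    (orbitObj w).toSet →[G] Y.toSet :=
  (MulActionHom.snd G X.toSet Y.toSet).comp (orbitIncl w)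

/-- A `G`-map from a transitive `G`-set to a product factors over an orbit. -/
theorem exists_orbit_factor {X Y Z : Orb F} (a : Z.toSet →[G] X.toSet)
    (b : Z.toSet →[G] Y.toSet) : ∃ (w : ProdOrbit X Y) (p : Z.toSet →[G] (orbitObj w).toSet),
      (orbitFst w).comp p = a ∧ (orbitSnd w).comp p = b := by
  -- `Z` is transitive, so the image of `(a, b)` is a single orbit, namely that of the image of the
  -- base coset.
  let w : ProdOrbit X Y := Quotient.mk _ (a ((1 : G) : G ⧸ Z.H), b ((1 : G) : G ⧸ Z.H))
  have h (z : Z.toSet) : ∃ z', orbitIncl w z' = (a z, b z) := by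
    rw [exists_orbitIncl_eq_iff]
    obtain ⟨g, rfl⟩ := QuotientGroup.mk_surjective z
    refine Quotient.sound ⟨g, ?_⟩
    change (g • a _, g • b _) = _
    rw [← map_smul, ← map_smul]
    simp
  choose p hp using h
  -- The pointwise choice `p` is forced by injectivity of the inclusion, hence is equivariant.
  refine ⟨w, ⟨p, fun g z => orbitIncl_injective w ?_⟩, ?_, ?_⟩
  · rw [map_smul, hp, hp, map_smul, map_smul]
    rfl
  · ext z
    exact congrArg Prod.fst (hp z)
  · ext z
    exact congrArg Prod.snd (hp z)

/-- The factorisation of a `G`-map to a product over an orbit is unique. -/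
theorem orbit_factor_unique {X Y Z : Orb F} {w w' : ProdOrbit X Y}
    {p : Z.toSet →[G] (orbitObj w).toSet} {p' : Z.toSet →[G] (orbitObj w').toSet}
    (h1 : (orbitFst w).comp p = (orbitFst w').comp p')
    (h2 : (orbitSnd w).comp p = (orbitSnd w').comp p') :
    (⟨w, p⟩ : Σ w : ProdOrbit X Y, Z.toSet →[G] (orbitObj w).toSet) = ⟨w', p'⟩ := by
  have h (z : Z.toSet) : orbitIncl w (p z) = orbitIncl w' (p' z) :=
    Prod.ext (DFunLike.congr_fun h1 z) (DFunLike.congr_fun h2 z)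
  obtain rfl : w = w' := by
    rw [← mk_orbitIncl w (p ((1 : G) : G ⧸ Z.H)), h, mk_orbitIncl]
  congr 1
  ext z
  exact orbitIncl_injective w (h z)

end

section

variable {G : Type u} [Group G] {F : FiniteFamily G} {R : Type u} [CommRing R]

/-! ### A basis of the morphisms of the Hecke category -/

/-- The linear map underlying a morphism of the Hecke category. -/
noncomputable def heckeLin {X Y : Orb F} :
    ((⟨X⟩ : HeckeCat R F) ⟶ ⟨Y⟩) →ₗ[R] MonoidAlgebra R X.toSet →ₗ[R] MonoidAlgebra R Y.toSet where
  toFun φ := φ.hom.hom.toLinearMap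
  map_add' _ _ := rfl
  map_smul' _ _ := rfl

theorem heckeLin_smul {X Y : Orb F} (φ : (⟨X⟩ : HeckeCat R F) ⟶ ⟨Y⟩) (g : G)
    (v : MonoidAlgebra R X.toSet) :
    heckeLin φ (Representation.ofMulAction R G X.toSet g v) =
      Representation.ofMulAction R G Y.toSet g (heckeLin φ v) :=
  Rep.hom_comm_apply φ.hom g v

/-- The coefficient at `y` of the image of `x` under a morphism `R[X] → R[Y]`. -/
noncomputable def coef {X Y : Orb F} (x : X.toSet) (y : Y.toSet) :
    ((⟨X⟩ : HeckeCat R F) ⟶ ⟨Y⟩) →ₗ[R] R where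
  toFun φ := (heckeLin φ (MonoidAlgebra.single x 1)).coeff y
  map_add' _ _ := rfl
  map_smul' _ _ := rfl

theorem hecke_ext_coef {X Y : Orb F} {φ ψ : (⟨X⟩ : HeckeCat R F) ⟶ ⟨Y⟩}
    (h : ∀ x y, coef x y φ = coef x y ψ) : φ = ψ := by
  apply hecke_ext
  apply perm_ext
  intro x
  apply MonoidAlgebra.ext
  ext y
  exact h x y

/-- Equivariance makes the matrix of a morphism constant on the diagonal orbits, so one scalar per
orbit of `X × Y` records it. -/
theorem coef_smul {X Y : Orb F} (φ : (⟨X⟩ : HeckeCat R F) ⟶ ⟨Y⟩) (g : G) (x : X.toSet)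
    (y : Y.toSet) : coef (g • x) (g • y) φ = coef x y φ := by
  change (heckeLin φ (MonoidAlgebra.single (g • x) 1)).coeff (g • y) = _
  rw [← Representation.ofMulAction_single, heckeLin_smul, Representation.coeff_ofMulAction,
    inv_smul_smul]
  rfl

/-! ### Pushforwards and transfers along `G`-maps, and the orbit basis built from them. -/

/-- The functor from transitive `G`-sets to the Hecke category. -/
noncomputable abbrev orbToHecke (R : Type u) [CommRing R] (F : FiniteFamily G) :
    Orb F ⥤ HeckeCat R F :=
  Free.embedding ℤ (Orb F) ⋙ sigma F ⋙ pi R F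

variable (R) in
/-- The morphism `R[X] → R[Y]` that extends a `G`-map. -/
noncomputable def push {X Y : Orb F} (f : X.toSet →[G] Y.toSet) : (⟨X⟩ : HeckeCat R F) ⟶ ⟨Y⟩ :=
  (orbToHecke R F).map (X := X) (Y := Y) f

theorem push_id (X : Orb F) : push R (MulActionHom.id G : X.toSet →[G] X.toSet) = 𝟙 _ :=
  (orbToHecke R F).map_id X

theorem heckeLin_push {X Y : Orb F} (f : X.toSet →[G] Y.toSet) (x : X.toSet) :
    heckeLin (push R f) (MonoidAlgebra.single x 1) = MonoidAlgebra.single (f x) 1 :=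
  sigma_pi_map_single R (X := X) (Y := Y) f x

/-- The diagram `X ← Z → Z` of a `G`-map, with the identity as right leg. -/
def transferSpan {X Z : Orb F} (f : Z.toSet →[G] X.toSet) : Span X Z :=
  { Span.ofMap (MulActionHom.id G : Z.toSet →[G] Z.toSet) with left := f }

variable (R) in
/-- The transfer `R[X] → R[Z]` of a `G`-map `Z → X`. -/
noncomputable def transfer {X Z : Orb F} (f : Z.toSet →[G] X.toSet) :
    (⟨X⟩ : HeckeCat R F) ⟶ ⟨Z⟩ :=
  (transferSpan f).hecke R

theorem finite_fibre {X Z : Orb F} (f : Z.toSet →[G] X.toSet) (x : X.toSet) :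
    {z | f z = x}.Finite :=
  (transferSpan f).finite_fibre x

/-- The transfer spreads `x` over its fibre under `f`, and the push counts the points that land on
`y`. The fibre is finite, so `Nat.card` is a true count; identities between morphisms thereby reduce
to bijections. -/
theorem coef_transfer_comp {X Y Z : Orb F} (f : Z.toSet →[G] X.toSet) (p : Z.toSet →[G] Y.toSet)
    (x : X.toSet) (y : Y.toSet) :
    coef x y (transfer R f ≫ push R p) = Nat.card {z : Z.toSet // f z = x ∧ p z = y} := by
  classical
  have h : heckeLin (transfer R f) (MonoidAlgebra.single x 1) =
      ∑ z ∈ (finite_fibre f x).toFinset, MonoidAlgebra.single z (1 : R) :=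
    (transferSpan f).linear_single R x
  change (heckeLin (push R p) (heckeLin (transfer R f) (MonoidAlgebra.single x 1))).coeff y = _
  rw [h, map_sum]
  simp only [heckeLin_push]
  rw [MonoidAlgebra.coeff_sum, Finsupp.finsetSum_apply]
  simp only [MonoidAlgebra.coeff_single, Finsupp.single_apply]
  rw [Finset.sum_boole]
  congr 1
  rw [← Fintype.card_coe, ← Nat.card_eq_fintype_card]
  refine Nat.card_congr (Equiv.subtypeEquivRight fun z => ?_)
  simp

/-- Lets `coef_transfer_comp` apply to a transfer alone. -/
theorem transfer_comp_push_id {X Z : Orb F} (f : Z.toSet →[G] X.toSet) :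
    transfer R f ≫ push R (MulActionHom.id G : Z.toSet →[G] Z.toSet) = transfer R f := by
  rw [push_id, Category.comp_id]

/-- A `G`-map over `X` sends the transfer of its source to a multiple of the transfer of its
target. -/
theorem exists_transfer_comp (R : Type u) [CommRing R] {X Z Z' : Orb F} (f : Z'.toSet →[G] X.toSet)
    (p : Z.toSet →[G] Z'.toSet) :
    ∃ d : R, transfer R (f.comp p) ≫ push R p = d • transfer R f := by
  -- Translation by `g` identifies the fibres of `p`; as `Z'` is transitive they all have the same
  -- size, and the factor `d` is that size.
  have hc (g : G) (z : Z'.toSet) : Nat.card {y // p y = g • z} = Nat.card {y // p y = z} := by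
    refine Nat.card_congr ⟨fun y => ⟨g⁻¹ • y.1, by rw [map_smul, y.2, inv_smul_smul]⟩,
      fun y => ⟨g • y.1, by rw [map_smul, y.2]⟩, fun y => ?_, fun y => ?_⟩ <;> simp
  refine ⟨(Nat.card {y // p y = ((1 : G) : G ⧸ Z'.H)} : R), hecke_ext_coef fun x z => ?_⟩
  rw [map_smul, coef_transfer_comp, ← transfer_comp_push_id, coef_transfer_comp]
  have h2 : Nat.card {y // p y = ((1 : G) : G ⧸ Z'.H)} = Nat.card {y // p y = z} := by
    obtain ⟨g, rfl⟩ := QuotientGroup.mk_surjective z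
    simpa using (hc g ((1 : G) : G ⧸ Z'.H)).symm
  rw [h2, smul_eq_mul, ← Nat.cast_mul, ← Nat.card_prod]
  congr 1
  -- The second factor is a single point if `f z = x` and empty otherwise, so the product is the
  -- fibre of `p` over `z` exactly when `z` lies over `x`.
  refine Nat.card_congr ⟨fun y => (⟨y.1, y.2.2⟩, ⟨z, (congrArg f y.2.2).symm.trans y.2.1, rfl⟩),
    fun y => ⟨y.1.1, (congrArg f (y.1.2.trans y.2.2.2.symm)).trans y.2.2.1, y.1.2⟩,
    fun y => rfl, fun y => Prod.ext rfl (Subtype.ext y.2.2.2.symm)⟩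

variable (R) in
/-- The basic morphism `X ← w → Y` of the Hecke category given by an orbit `w` in `X × Y`. -/
noncomputable def orbitHecke {X Y : Orb F} (w : ProdOrbit X Y) : (⟨X⟩ : HeckeCat R F) ⟶ ⟨Y⟩ :=
  transfer R (orbitFst w) ≫ push R (orbitSnd w)

-- The orbit embeds in `X × Y`, so at most one of its points lies over `(x, y)`: the matrix is the
-- indicator function of `w`.
open Classical in
theorem coef_orbitHecke {X Y : Orb F} (w : ProdOrbit X Y) (x : X.toSet) (y : Y.toSet) :
    coef x y (orbitHecke R w) = if (Quotient.mk _ (x, y) : ProdOrbit X Y) = w then 1 else 0 := by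
  rw [orbitHecke, coef_transfer_comp]
  have hs : Subsingleton {z : (orbitObj w).toSet // orbitFst w z = x ∧ orbitSnd w z = y} :=
    ⟨fun z z' => Subtype.ext (orbitIncl_injective w
      (Prod.ext (z.2.1.trans z'.2.1.symm) (z.2.2.trans z'.2.2.symm)))⟩
  split_ifs with h
  · obtain ⟨z, hz⟩ := (exists_orbitIncl_eq_iff w (x, y)).mpr h
    have : Nonempty {z : (orbitObj w).toSet // orbitFst w z = x ∧ orbitSnd w z = y} :=
      ⟨⟨z, congrArg Prod.fst hz, congrArg Prod.snd hz⟩⟩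
    rw [Nat.card_unique, Nat.cast_one]
  · have : IsEmpty {z : (orbitObj w).toSet // orbitFst w z = x ∧ orbitSnd w z = y} :=
      ⟨fun z => h ((exists_orbitIncl_eq_iff w (x, y)).mp ⟨z.1, Prod.ext z.2.1 z.2.2⟩)⟩
    rw [Nat.card_of_isEmpty, Nat.cast_zero]

/-- `X × Y` may have infinitely many orbits, but each meets `{H} × Y` because `X` is transitive, and
the image of the base coset has finite support. -/
theorem finite_orbit_coef {X Y : Orb F} (φ : (⟨X⟩ : HeckeCat R F) ⟶ ⟨Y⟩) :
    (Function.support fun w : ProdOrbit X Y => coef w.out.1 w.out.2 φ).Finite := by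
  let x : X.toSet := ((1 : G) : G ⧸ X.H)
  refine ((heckeLin φ (MonoidAlgebra.single x 1)).coeff.support.finite_toSet.image
    (fun y => (Quotient.mk _ (x, y) : ProdOrbit X Y))).subset ?_
  intro w hw
  -- Translating the representative by `g⁻¹` brings its first coordinate to the base coset without
  -- changing the coefficient.
  obtain ⟨g, hg⟩ := QuotientGroup.mk_surjective w.out.1
  refine ⟨g⁻¹ • w.out.2, ?_, ?_⟩
  · rw [Function.mem_support, ← coef_smul φ g⁻¹, ← hg] at hw
    simpa [x, coef] using hw
  · conv_rhs => rw [← Quotient.out_eq w]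
    refine Quotient.sound ⟨g⁻¹, ?_⟩
    refine Prod.ext ?_ rfl
    change g⁻¹ • w.out.1 = x
    rw [← hg]
    simp [x]

/-- The coordinates of a morphism of the Hecke category. -/
noncomputable def heckeCoord (X Y : Orb F) :
    ((⟨X⟩ : HeckeCat R F) ⟶ ⟨Y⟩) →ₗ[R] ProdOrbit X Y →₀ R where
  toFun φ := Finsupp.ofSupportFinite _ (finite_orbit_coef φ)
  map_add' φ ψ := Finsupp.ext fun w => map_add (coef w.out.1 w.out.2) φ ψ
  map_smul' r φ := Finsupp.ext fun w => map_smul (coef w.out.1 w.out.2) r φ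

theorem heckeCoord_orbitHecke {X Y : Orb F} (w : ProdOrbit X Y) :
    heckeCoord X Y (orbitHecke R w) = Finsupp.single w 1 := by
  classical
  ext w'
  refine (coef_orbitHecke w _ _).trans ?_
  rw [Finsupp.single_apply, Prod.mk.eta, Quotient.out_eq]
  simp only [eq_comm]

theorem heckeCoord_injective (X Y : Orb F) :
    Function.Injective (heckeCoord (R := R) X Y) := by
  intro φ ψ h
  refine hecke_ext_coef fun x y => ?_
  let w : ProdOrbit X Y := Quotient.mk _ (x, y)
  obtain ⟨g, hg⟩ := Quotient.mk_out (s := MulAction.orbitRel G (X.toSet × Y.toSet)) (x, y)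
  have h1 : coef w.out.1 w.out.2 φ = coef w.out.1 w.out.2 ψ := DFunLike.congr_fun h w
  rw [← hg] at h1
  change coef (g • x) (g • y) φ = coef (g • x) (g • y) ψ at h1
  rwa [coef_smul, coef_smul] at h1

theorem heckeCoord_surjective (X Y : Orb F) :
    Function.Surjective (heckeCoord (R := R) X Y) := by
  intro c
  induction c using Finsupp.induction_linear with
  | zero => exact ⟨0, map_zero _⟩
  | add c c' h h' =>
    obtain ⟨φ, rfl⟩ := h
    obtain ⟨ψ, rfl⟩ := h'
    exact ⟨φ + ψ, map_add _ _ _⟩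
  | single w r =>
    refine ⟨r • orbitHecke R w, ?_⟩
    rw [map_smul, heckeCoord_orbitHecke, Finsupp.smul_single, smul_eq_mul, mul_one]

variable (R) in
/-- The basis of the morphisms `R[X] → R[Y]` given by the orbits in `X × Y`. -/
noncomputable def orbitBasis (X Y : Orb F) :
    Module.Basis (ProdOrbit X Y) R ((⟨X⟩ : HeckeCat R F) ⟶ ⟨Y⟩) :=
  .ofRepr (LinearEquiv.ofBijective (heckeCoord X Y)
    ⟨heckeCoord_injective X Y, heckeCoord_surjective X Y⟩)

theorem orbitBasis_apply {X Y : Orb F} (w : ProdOrbit X Y) :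
    orbitBasis R X Y w = orbitHecke R w := by
  rw [Module.Basis.apply_eq_iff]
  exact heckeCoord_orbitHecke w

end

section

variable {G : Type u} [Group G] {F : FiniteFamily G} {R : Type u} [CommRing R]

/-! ### Evaluation of induced modules through slice categories -/

/-- A `G`-map as a morphism of the orbit category. -/
noncomputable def orbMap {Y Z : OrbitCat F} (f : Y.orb.toSet →[G] Z.orb.toSet) : Y ⟶ Z :=
  (Free.embedding ℤ (Orb F)).map (X := Y.orb) (Y := Z.orb) f

/-- The `G`-maps generate the morphisms of the orbit category. -/
theorem orbitCat_hom_ind {X Y : OrbitCat F} {p : (X ⟶ Y) → Prop}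
    (of : ∀ f : X.orb.toSet →[G] Y.orb.toSet, p (orbMap f)) (zero : p 0)
    (sub : ∀ a b, p a → p b → p (a - b)) (a : X ⟶ Y) : p a := by
  have neg (a) (ha : p a) : p (-a) := by simpa using sub 0 a zero ha
  have add (a b) (ha : p a) (hb : p b) : p (a + b) := by simpa using sub a (-b) ha (neg b hb)
  have key (a : (X.orb ⟶ Y.orb) →₀ ℤ) : p a := by
    induction a using Finsupp.induction_linear with
    | zero => exact zero
    | add a b ha hb => exact add a b ha hb
    | single f n =>
      -- Integer multiples of `f` are reached by repeatedly adding or subtracting `f`.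
      have h : (Finsupp.single f n : (X.orb ⟶ Y.orb) →₀ ℤ) = n • Finsupp.single f 1 := by simp
      rw [h]
      induction n using Int.induction_on with
      | zero => rw [zero_smul]; exact zero
      | succ n hn => rw [add_smul, one_smul]; exact add _ _ (hn (by simp)) (of f)
      | pred n hn => rw [sub_smul, one_smul]; exact sub _ _ (hn (by simp)) (of f)
  exact key a

/-- The functor from the slice category over `X` to the orbit category. -/
noncomputable abbrev sliceForget (X : Orb F) : Over X ⥤ OrbitCat F :=
  Over.forget X ⋙ Free.embedding ℤ (Orb F)

/-- The restriction of a contravariant functor on the orbit category to a slice category. -/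
noncomputable abbrev sliceRes (X : Orb F) (M : (OrbitCat F)ᵒᵖ ⥤ ModuleCat.{u} R) :
    (Over X)ᵒᵖ ⥤ ModuleCat.{u} R :=
  (sliceForget X).op ⋙ M

/-- The restriction of a natural transformation to a slice category. -/
noncomputable abbrev sliceResMap (X : Orb F) {M M' : (OrbitCat F)ᵒᵖ ⥤ ModuleCat.{u} R} (f : M ⟶ M') :
    sliceRes X M ⟶ sliceRes X M' :=
  Functor.whiskerLeft (sliceForget X).op f

variable (R) in
/-- The functor `[X, ?]` from the orbit category, the morphisms being taken in the Hecke
category. -/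
noncomputable abbrev heckeFrom (X : Orb F) : OrbitCat F ⥤ ModuleCat.{u} R :=
  (homFrom R (sigma F ⋙ pi R F)).obj (op ⟨X⟩)

theorem heckeFrom_map_sub {X : Orb F} {Y Z : OrbitCat F} (f g : Y ⟶ Z)
    (φ : (heckeFrom R X).obj Y) :
    (heckeFrom R X).map (f - g) φ = (heckeFrom R X).map f φ - (heckeFrom R X).map g φ := by
  refine Eq.trans ?_ (Preadditive.comp_sub (show (⟨X⟩ : HeckeCat R F) ⟶ ⟨Y.orb⟩ from φ)
    ((sigma F ⋙ pi R F).map f) ((sigma F ⋙ pi R F).map g))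
  exact congrArg ((show (⟨X⟩ : HeckeCat R F) ⟶ ⟨Y.orb⟩ from φ) ≫ ·)
    (Functor.map_sub (sigma F ⋙ pi R F))

theorem heckeFrom_map_zero {X : Orb F} {Y Z : OrbitCat F} (φ : (heckeFrom R X).obj Y) :
    (heckeFrom R X).map (0 : Y ⟶ Z) φ = 0 := by
  simpa using heckeFrom_map_sub (0 : Y ⟶ Z) 0 φ

variable (R) in
/-- The tensor product over the slice category that computes the induced module at `X`. -/
abbrev SliceTensor (X : Orb F) (N : (Over X)ᵒᵖ ⥤ ModuleCat.{u} R) : Type u :=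
  CatTensor N (sliceForget X ⋙ heckeFrom R X)

/-- The map on tensor products over the slice category induced by a natural transformation. -/
noncomputable abbrev sliceTensorMap (X : Orb F) {N N' : (Over X)ᵒᵖ ⥤ ModuleCat.{u} R}
    (f : N ⟶ N') : SliceTensor R X N →ₗ[R] SliceTensor R X N' :=
  ctmap f (𝟙 (sliceForget X ⋙ heckeFrom R X))

theorem sliceTensorMap_id (X : Orb F) (N : (Over X)ᵒᵖ ⥤ ModuleCat.{u} R)
    (t : SliceTensor R X N) : sliceTensorMap X (𝟙 N) t = t := by
  rw [sliceTensorMap, ctmap_id, LinearMap.id_apply]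

theorem sliceTensorMap_comp (X : Orb F) {N N' N'' : (Over X)ᵒᵖ ⥤ ModuleCat.{u} R}
    (f : N ⟶ N') (g : N' ⟶ N'') (t : SliceTensor R X N) :
    sliceTensorMap X (f ≫ g) t = sliceTensorMap X g (sliceTensorMap X f t) := by
  rw [sliceTensorMap, sliceTensorMap, sliceTensorMap, ← LinearMap.comp_apply, ← ctmap_comp,
    Category.comp_id]

theorem sliceTensorMap_add (X : Orb F) {N N' : (Over X)ᵒᵖ ⥤ ModuleCat.{u} R}
    (f g : N ⟶ N') (t : SliceTensor R X N) :
    sliceTensorMap X (f + g) t = sliceTensorMap X f t + sliceTensorMap X g t := by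
  rw [sliceTensorMap, ctmap_add_left, LinearMap.add_apply]

/-- The natural map from the tensor product over the slice category to the tensor product over
the orbit category. -/
noncomputable def ofSlice (X : Orb F) (M : (OrbitCat F)ᵒᵖ ⥤ ModuleCat.{u} R) :
    SliceTensor R X (sliceRes X M) →ₗ[R] CatTensor M (heckeFrom R X) :=
  ctlift (fun s => ctmulHom M (heckeFrom R X) ((sliceForget X).obj s))
    fun _ _ α m a => ctmul_map M (heckeFrom R X) ((sliceForget X).map α) m a

theorem ofSlice_ctmul (X : Orb F) (M : (OrbitCat F)ᵒᵖ ⥤ ModuleCat.{u} R) (s : Over X)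
    (m : M.obj (op ((sliceForget X).obj s))) (a : (heckeFrom R X).obj ((sliceForget X).obj s)) :
    ofSlice X M (ctmul (sliceRes X M) (sliceForget X ⋙ heckeFrom R X) s m a) =
      ctmul M (heckeFrom R X) ((sliceForget X).obj s) m a :=
  ctlift_ctmul _ _ _ _ _

theorem ofSlice_naturality (X : Orb F) {M M' : (OrbitCat F)ᵒᵖ ⥤ ModuleCat.{u} R} (f : M ⟶ M')
    (t : SliceTensor R X (sliceRes X M)) :
    ofSlice X M' (sliceTensorMap X (sliceResMap X f) t) =
      ctmap f (𝟙 (heckeFrom R X)) (ofSlice X M t) := by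
  refine LinearMap.congr_fun (f := ofSlice X M' ∘ₗ sliceTensorMap X (sliceResMap X f))
    (g := ctmap f (𝟙 (heckeFrom R X)) ∘ₗ ofSlice X M) (catTensor_ext fun s m a => ?_) t
  rw [LinearMap.comp_apply, LinearMap.comp_apply, ctmap_ctmul]
  refine (ofSlice_ctmul X M' s _ _).trans ?_
  rw [ofSlice_ctmul, ctmap_ctmul]
  rfl

/-- A `G`-map as a morphism of the orbit category, with source in the image of the category of
transitive `G`-sets. -/
noncomputable def orbMor {Z : Orb F} {Y : OrbitCat F} (b : Z.toSet →[G] Y.orb.toSet) :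
    (Free.embedding ℤ (Orb F)).obj Z ⟶ Y :=
  (Free.embedding ℤ (Orb F)).map (X := Z) (Y := Y.orb) b

theorem orbMor_comp {Z Z' : Orb F} {Y : OrbitCat F} (b : Z.toSet →[G] Y.orb.toSet)
    (p : Z'.toSet →[G] Z.toSet) :
    orbMor (b.comp p) = (Free.embedding ℤ (Orb F)).map (X := Z') (Y := Z) p ≫ orbMor b :=
  (Free.embedding ℤ (Orb F)).map_comp (X := Z') (Y := Z) (Z := Y.orb) p b

theorem orbMor_comp_orbMap {Z : Orb F} {Y Y' : OrbitCat F} (b : Z.toSet →[G] Y.orb.toSet)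
    (f : Y.orb.toSet →[G] Y'.orb.toSet) :
    orbMor (f.comp b) =
      orbMor b ≫ orbMap f :=
  (Free.embedding ℤ (Orb F)).map_comp (X := Z) (Y := Y.orb) (Z := Y'.orb) b f

variable (R) in
/-- The transfer as an element of `[X, Z]`. -/
noncomputable def transferElt {X Z : Orb F} (a : Z.toSet →[G] X.toSet) :
    (heckeFrom R X).obj ((Free.embedding ℤ (Orb F)).obj Z) :=
  transfer R a

theorem exists_transferElt_map (R : Type u) [CommRing R] {X Z Z' : Orb F}
    (a : Z.toSet →[G] X.toSet) (p : Z'.toSet →[G] Z.toSet) :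
    ∃ d : R, (heckeFrom R X).map ((Free.embedding ℤ (Orb F)).map (X := Z') (Y := Z) p)
      (transferElt R (a.comp p)) = d • transferElt R a :=
  exists_transfer_comp R a p

/-- Linear maps out of `[X, Y]` are determined by their values on the basis of orbits. -/
theorem heckeFrom_ext {X : Orb F} {Y : OrbitCat F} {V : Type*} [AddCommGroup V] [Module R V]
    {f g : (heckeFrom R X).obj Y →ₗ[R] V}
    (h : ∀ w : ProdOrbit X Y.orb,
      f ((heckeFrom R X).map (orbMor (orbitSnd w)) (transferElt R (orbitFst w))) =
        g ((heckeFrom R X).map (orbMor (orbitSnd w)) (transferElt R (orbitFst w)))) : f = g := by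
  refine (orbitBasis R X Y.orb).ext fun w => ?_
  rw [orbitBasis_apply]
  exact h w

/-! ### The map back to the slice tensor product, defined on the orbit basis. -/

variable {X : Orb F} (M : AddMod R (OrbitCat F))

/-- The pullback of an element along `b : Z → Y`, tensored with the transfer of `a : Z → X`. -/
noncomputable def sliceTerm {Z : Orb F} {Y : OrbitCat F} (a : Z.toSet →[G] X.toSet)
    (b : Z.toSet →[G] Y.orb.toSet) : M.obj.obj (op Y) →ₗ[R]
      SliceTensor R X (sliceRes X M.obj) :=
  (ctmulHom (sliceRes X M.obj) (sliceForget X ⋙ heckeFrom R X)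
      (Over.mk (Y := Z) (X := X) a)).flip (transferElt R a) ∘ₗ (M.obj.map (orbMor b).op).hom

theorem sliceTerm_apply {Z : Orb F} {Y : OrbitCat F} (a : Z.toSet →[G] X.toSet)
    (b : Z.toSet →[G] Y.orb.toSet) (m : M.obj.obj (op Y)) :
    sliceTerm M a b m = ctmul (sliceRes X M.obj) (sliceForget X ⋙ heckeFrom R X)
      (Over.mk (Y := Z) (X := X) a) (M.obj.map (orbMor b).op m) (transferElt R a) := rfl

/-- In the slice, `p` is a morphism from `a ∘ p` to `a`. Pulling back along `p` on the left of the
tensor sign can therefore be exchanged for pushing `tr(a ∘ p)` along `p` on the right, which gives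
the factor `d`. -/
theorem sliceTerm_comp {Z Z' : Orb F} {Y : OrbitCat F} (a : Z.toSet →[G] X.toSet)
    (b : Z.toSet →[G] Y.orb.toSet) (p : Z'.toSet →[G] Z.toSet) (d : R)
    (hd : (heckeFrom R X).map ((Free.embedding ℤ (Orb F)).map (X := Z') (Y := Z) p)
      (transferElt R (a.comp p)) = d • transferElt R a)
    (m : M.obj.obj (op Y)) :
    sliceTerm M (a.comp p) (b.comp p) m = d • sliceTerm M a b m := by
  let q : Over.mk (Y := Z') (X := X) (a.comp p) ⟶ Over.mk (Y := Z) (X := X) a :=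
    Over.homMk p
  rw [sliceTerm_apply, sliceTerm_apply, orbMor_comp, op_comp, M.obj.map_comp]
  refine (ctmul_map (sliceRes X M.obj) (sliceForget X ⋙ heckeFrom R X) q
    (M.obj.map (orbMor b).op m) (transferElt R (a.comp p))).trans ?_
  refine (congrArg (ctmul (sliceRes X M.obj) (sliceForget X ⋙ heckeFrom R X)
      (Over.mk (Y := Z) (X := X) a) (M.obj.map (orbMor b).op m)) hd).trans ?_
  exact map_smul (ctmulHom (sliceRes X M.obj) (sliceForget X ⋙ heckeFrom R X)
      (Over.mk (Y := Z) (X := X) a) (M.obj.map (orbMor b).op m)) d _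

variable (X)

/-- The bilinear map `(m, φ) ↦ m ⊗ φ` with values in the tensor product over the slice category. -/
noncomputable def toSliceBil (Y : OrbitCat F) : M.obj.obj (op Y) →ₗ[R] (heckeFrom R X).obj Y →ₗ[R]
    SliceTensor R X (sliceRes X M.obj) :=
  ((orbitBasis R X Y.orb).constr R).toLinearMap ∘ₗ
    LinearMap.pi fun w => sliceTerm M (orbitFst w) (orbitSnd w)

theorem toSliceBil_orbit {Y : OrbitCat F} (m : M.obj.obj (op Y)) (w : ProdOrbit X Y.orb) :
    toSliceBil X M Y m
        ((heckeFrom R X).map (orbMor (orbitSnd w)) (transferElt R (orbitFst w))) =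
      sliceTerm M (orbitFst w) (orbitSnd w) m := by
  refine (congrArg (toSliceBil X M Y m) (orbitBasis_apply w).symm).trans ?_
  exact (orbitBasis R X Y.orb).constr_basis R _ w

variable {X}

/-- `toSliceBil` is prescribed only on orbits of `X × Y`. Arbitrary legs `(a, b)` factor over an
orbit through some `p`, and both sides acquire the same scalar, so the prescribing formula holds for
all legs. -/
theorem toSliceBil_transfer {Z : Orb F} {Y : OrbitCat F} (a : Z.toSet →[G] X.toSet)
    (b : Z.toSet →[G] Y.orb.toSet) (m : M.obj.obj (op Y)) :
    toSliceBil X M Y m ((heckeFrom R X).map (orbMor b) (transferElt R a)) =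
      sliceTerm M a b m := by
  obtain ⟨w, p, rfl, rfl⟩ := exists_orbit_factor a b
  obtain ⟨d, hd⟩ := exists_transferElt_map R (orbitFst w) p
  rw [sliceTerm_comp M _ _ p d hd, orbMor_comp, Functor.map_comp, ModuleCat.comp_apply, hd,
    map_smul, map_smul, toSliceBil_orbit]

variable (X)

/-- Both sides are additive in `α`, which reduces the claim to a `G`-map and then to `φ` in the
orbit basis. -/
theorem toSliceBil_balanced {Y Z : OrbitCat F} (α : Y ⟶ Z) (m : M.obj.obj (op Z))
    (φ : (heckeFrom R X).obj Y) :
    toSliceBil X M Y (M.obj.map α.op m) φ = toSliceBil X M Z m ((heckeFrom R X).map α φ) := by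
  have hM : M.obj.Additive := M.property
  induction α using orbitCat_hom_ind with
  | zero =>
    have h : M.obj.map (0 : Y ⟶ Z).op = 0 := M.obj.map_zero _ _
    rw [heckeFrom_map_zero, map_zero, h]
    exact LinearMap.map_zero₂ (toSliceBil X M Y) φ
  | sub α β hα hβ =>
    rw [heckeFrom_map_sub, map_sub, ← hα, ← hβ, op_sub, Functor.map_sub, ← LinearMap.sub_apply,
      ← map_sub]
    rfl
  | of f =>
    refine LinearMap.congr_fun (f := toSliceBil X M Y (M.obj.map _ m))
      (g := toSliceBil X M Z m ∘ₗ ((heckeFrom R X).map (orbMap f)).hom)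
      (heckeFrom_ext fun w => ?_) φ
    rw [toSliceBil_orbit, LinearMap.comp_apply, sliceTerm_apply]
    -- Composing with `f` gives legs that need not embed in `X × Z`, so the formula for arbitrary
    -- legs is required here.
    have h := toSliceBil_transfer M (orbitFst w)
      (f.comp (orbitSnd w)) m
    rw [sliceTerm_apply, orbMor_comp_orbMap, op_comp, M.obj.map_comp, Functor.map_comp] at h
    exact h.symm

/-- The natural map from the tensor product over the orbit category to the tensor product over
the slice category. -/
noncomputable def toSlice :
    CatTensor M.obj (heckeFrom R X) →ₗ[R] SliceTensor R X (sliceRes X M.obj) :=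
  ctlift (toSliceBil X M) fun _ _ => toSliceBil_balanced X M

/-- Over the orbit category `b^* m ⊗ tr(a) = m ⊗ b_* tr(a)` returns the original tensor. With
naturality of both maps, this one-sided identity makes `CatTensor M.obj (heckeFrom R X)` a natural
retract of the slice tensor product, which is all that exactness needs. -/
theorem ofSlice_toSlice (t : CatTensor M.obj (heckeFrom R X)) :
    ofSlice X M.obj (toSlice X M t) = t := by
  refine LinearMap.congr_fun (f := ofSlice X M.obj ∘ₗ toSlice X M) (g := LinearMap.id)
    (catTensor_ext fun Y m φ => ?_) t
  rw [LinearMap.comp_apply, toSlice, ctlift_ctmul, LinearMap.id_apply]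
  refine LinearMap.congr_fun (f := ofSlice X M.obj ∘ₗ toSliceBil X M Y m)
    (g := ctmulHom M.obj (heckeFrom R X) Y m) (heckeFrom_ext fun w => ?_) φ
  rw [LinearMap.comp_apply, toSliceBil_orbit, sliceTerm_apply]
  refine (ofSlice_ctmul X M.obj _ _ _).trans ?_
  exact ctmul_map M.obj (heckeFrom R X) (orbMor (orbitSnd w)) m (transferElt R (orbitFst w))

theorem toSlice_naturality {M M' : AddMod R (OrbitCat F)} (f : M ⟶ M')
    (t : CatTensor M.obj (heckeFrom R X)) :
    toSlice X M' (ctmap f.hom (𝟙 (heckeFrom R X)) t) =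
      sliceTensorMap X (sliceResMap X f.hom) (toSlice X M t) := by
  refine LinearMap.congr_fun (f := toSlice X M' ∘ₗ ctmap f.hom (𝟙 (heckeFrom R X)))
    (g := sliceTensorMap X (sliceResMap X f.hom) ∘ₗ toSlice X M)
    (catTensor_ext fun Y m φ => ?_) t
  rw [LinearMap.comp_apply, LinearMap.comp_apply, ctmap_ctmul, toSlice, toSlice, ctlift_ctmul,
    ctlift_ctmul]
  refine LinearMap.congr_fun (f := toSliceBil X M' Y (f.hom.app (op Y) m))
    (g := sliceTensorMap X (sliceResMap X f.hom) ∘ₗ toSliceBil X M Y m)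
    (heckeFrom_ext fun w => ?_) φ
  rw [LinearMap.comp_apply, toSliceBil_orbit, toSliceBil_orbit, sliceTerm_apply, sliceTerm_apply]
  refine Eq.trans ?_ (ctmap_ctmul _ _ _ _ _).symm
  refine congrArg (fun v => ctmul (sliceRes X M'.obj) (sliceForget X ⋙ heckeFrom R X)
      (Over.mk (Y := orbitObj w) (X := X) (orbitFst w)) v (transferElt R (orbitFst w))) ?_
  exact (ConcreteCategory.congr_hom (f.hom.naturality (orbMor (orbitSnd w)).op) m).symm

end

section

/-! ### Lifting after restriction to a slice category -/

theorem epi_of_surjective {R : Type u} [CommRing R] {C : Type u} [Category.{u} C]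
    {W : ObjectProperty (Cᵒᵖ ⥤ ModuleCat.{u} R)}
    {M N : W.FullSubcategory} (f : M ⟶ N) (hf : ∀ x, Function.Surjective (f.hom.app x)) :
    Epi f := by
  constructor
  intro Z a b h
  apply ObjectProperty.hom_ext
  apply NatTrans.ext
  funext x
  apply ModuleCat.hom_ext
  apply LinearMap.ext
  intro n
  obtain ⟨m, rfl⟩ := hf x n
  exact congrArg (fun k => k.hom.app x m) h

/-! ### A lifting criterion for the restriction of a projective module along a functor. -/

section Lifting

variable {R : Type u} [CommRing R] {C S : Type u} [Category.{u} C] [Preadditive C]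
  [Category.{u} S]

variable (T : S ⥤ C) (P : AddMod R C) {N N' : Sᵒᵖ ⥤ ModuleCat.{u} R} (e : N ⟶ N')
  (g : T.op ⋙ P.obj ⟶ N')

/-- Pairs of an element `m` of `P(Y)` and a natural family of maps `[T s, Y] → N(s)` that lifts
`f ↦ g(f^* m)` along `e`. -/
def liftSub (Y : C) :
    Submodule R (P.obj.obj (op Y) × ∀ s : S, (T.obj s ⟶ Y) →+ N.obj (op s)) where
  carrier := {q | (∀ (s s' : S) (p : s ⟶ s') (f : T.obj s' ⟶ Y),
      q.2 s (T.map p ≫ f) = N.map p.op (q.2 s' f)) ∧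
    ∀ (s : S) (f : T.obj s ⟶ Y), e.app (op s) (q.2 s f) = g.app (op s) (P.obj.map f.op q.1)}
  add_mem' := by
    rintro a b ⟨h1, h2⟩ ⟨h1', h2'⟩
    refine ⟨fun s s' p f => ?_, fun s f => ?_⟩
    · exact (congrArg₂ (· + ·) (h1 s s' p f) (h1' s s' p f)).trans (map_add _ _ _).symm
    · refine (map_add _ _ _).trans ((congrArg₂ (· + ·) (h2 s f) (h2' s f)).trans ?_)
      refine (map_add _ _ _).symm.trans (congrArg _ ?_)
      exact (map_add (P.obj.map f.op).hom _ _).symm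
  zero_mem' := by
    refine ⟨fun s s' p f => (map_zero _).symm, fun s f => (map_zero _).trans ?_⟩
    refine (map_zero (g.app (op s)).hom).symm.trans (congrArg _ ?_)
    exact (map_zero (P.obj.map f.op).hom).symm
  smul_mem' := by
    rintro r a ⟨h1, h2⟩
    refine ⟨fun s s' p f => ?_, fun s f => ?_⟩
    · exact (congrArg (r • ·) (h1 s s' p f)).trans (map_smul _ _ _).symm
    · refine (map_smul _ _ _).trans ((congrArg (r • ·) (h2 s f)).trans ?_)
      refine (map_smul (g.app (op s)).hom r _).symm.trans (congrArg _ ?_)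
      exact (map_smul (P.obj.map f.op).hom r _).symm

/-- Pullback of pairs along a morphism. -/
def liftSubMap {Y Z : C} (α : Y ⟶ Z) : liftSub T P e g Z →ₗ[R] liftSub T P e g Y where
  toFun q := ⟨(P.obj.map α.op q.1.1, fun s => (q.1.2 s).comp (Preadditive.rightComp _ α)), by
    refine ⟨fun s s' p f => ?_, fun s f => ?_⟩
    · refine Eq.trans ?_ (q.2.1 s s' p (f ≫ α))
      exact congrArg (q.1.2 s) (Category.assoc _ _ _)
    · refine (q.2.2 s (f ≫ α)).trans (congrArg _ ?_)
      rw [op_comp, P.obj.map_comp]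
      rfl⟩
  map_add' q q' := Subtype.ext (Prod.ext (map_add _ _ _) rfl)
  map_smul' r q := Subtype.ext (Prod.ext (map_smul _ _ _) rfl)

/-- The contravariant module of pairs of an element of `P` and a lift. -/
def liftMod : AddMod R C where
  obj :=
    { obj := fun Y => ModuleCat.of R (liftSub T P e g Y.unop)
      map := fun α => ModuleCat.ofHom (liftSubMap T P e g α.unop)
      map_id := fun Y => by
        apply ModuleCat.hom_ext
        apply LinearMap.ext
        rintro ⟨⟨m, t⟩, h⟩
        refine Subtype.ext (Prod.ext ?_ ?_)
        · exact ConcreteCategory.congr_hom (P.obj.map_id Y) m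
        · funext s
          ext f
          exact congrArg (t s) (Category.comp_id f)
      map_comp := fun α β => by
        apply ModuleCat.hom_ext
        apply LinearMap.ext
        rintro ⟨⟨m, t⟩, h⟩
        refine Subtype.ext (Prod.ext ?_ ?_)
        · exact ConcreteCategory.congr_hom (P.obj.map_comp α β) m
        · funext s
          ext f
          exact congrArg (t s) (Category.assoc _ _ _).symm }
  property := by
    have hP : P.obj.Additive := P.property
    refine ⟨fun {Y Z α β} => ?_⟩
    apply ModuleCat.hom_ext
    apply LinearMap.ext
    rintro ⟨⟨m, t⟩, h⟩
    refine Subtype.ext (Prod.ext ?_ ?_)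
    · exact ConcreteCategory.congr_hom (P.obj.map_add (f := α) (g := β)) m
    · funext s
      ext f
      exact (congrArg (t s) (Preadditive.comp_add _ _ _ f α.unop β.unop)).trans (map_add _ _ _)

/-- The projection from pairs to `P`. -/
def liftModFst : liftMod T P e g ⟶ P :=
  ObjectProperty.homMk
    { app := fun Y => ModuleCat.ofHom
        (LinearMap.fst R _ _ ∘ₗ (liftSub T P e g Y.unop).subtype)
      naturality := fun _ _ _ => rfl }

/-- If every element of a projective module belongs to a pair, then `g` lifts along `e`. -/
theorem exists_lift_of_liftSub [Projective P]
    (h : ∀ (Y : C) (m : P.obj.obj (op Y)), ∃ t, (m, t) ∈ liftSub T P e g Y) :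
    ∃ l : T.op ⋙ P.obj ⟶ N, l ≫ e = g := by
  -- By hypothesis the projection from pairs to `P` is pointwise surjective, so projectivity gives a
  -- section `k`: a choice of lifts compatible with all morphisms of `C`.
  have : Epi (liftModFst T P e g) := epi_of_surjective _ fun Y m => by
    obtain ⟨t, ht⟩ := h Y.unop m
    exact ⟨⟨(m, t), ht⟩, rfl⟩
  let k := Projective.factorThru (𝟙 P) (liftModFst T P e g)
  have hk : k ≫ liftModFst T P e g = 𝟙 P := Projective.factorThru_comp _ _
  have hk' (Y : C) (m : P.obj.obj (op Y)) : (k.hom.app (op Y) m).1.1 = m :=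
    congrArg (fun a => a.hom.app (op Y) m) hk
  -- As in the Yoneda lemma, the value at `s` is the chosen family of lifts for `m` evaluated at the
  -- identity of `T s`.
  refine ⟨{ app := fun s => ModuleCat.ofHom
              { toFun := fun m => (k.hom.app (op (T.obj s.unop)) m).1.2 s.unop (𝟙 _)
                map_add' := fun m m' => by rw [map_add]; rfl
                map_smul' := fun r m => by rw [map_smul]; rfl }
            naturality := ?_ }, ?_⟩
  · intro s s' p
    apply ModuleCat.hom_ext
    apply LinearMap.ext
    intro m
    change (k.hom.app (op (T.obj s'.unop)) (P.obj.map (T.map p.unop).op m)).1.2 s'.unop (𝟙 _) =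
      N.map p ((k.hom.app (op (T.obj s.unop)) m).1.2 s.unop (𝟙 _))
    have h1 : k.hom.app (op (T.obj s'.unop)) (P.obj.map (T.map p.unop).op m) =
        liftSubMap T P e g (T.map p.unop) (k.hom.app (op (T.obj s.unop)) m) :=
      ConcreteCategory.congr_hom (k.hom.naturality (T.map p.unop).op) m
    rw [h1]
    -- After naturality of `k`, both sides are values of one family, at `id ≫ T p` and at `T p ≫
    -- id`.
    refine Eq.trans ?_ ((k.hom.app (op (T.obj s.unop)) m).2.1 _ _ p.unop (𝟙 _))
    refine congrArg ((k.hom.app (op (T.obj s.unop)) m).1.2 s'.unop) ?_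
    exact (Category.id_comp _).trans (Category.comp_id _).symm
  · apply NatTrans.ext
    funext s
    apply ModuleCat.hom_ext
    apply LinearMap.ext
    intro m
    refine ((k.hom.app (op (T.obj s.unop)) m).2.2 s.unop (𝟙 _)).trans ?_
    rw [hk', op_id, P.obj.map_id]
    rfl

end Lifting

variable {G : Type u} [Group G] {F : FiniteFamily G} {R : Type u} [CommRing R]

/-- Restrictions to a slice category of projective modules lift along natural transformations. -/
theorem exists_slice_lift (X : Orb F) (P : AddMod R (OrbitCat F)) [Projective P]
    {N N' : (Over X)ᵒᵖ ⥤ ModuleCat.{u} R} (e : N ⟶ N') (g : sliceRes X P.obj ⟶ N')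
    (h : ∀ s m, ∃ n, e.app s n = g.app s m) :
    ∃ l : sliceRes X P.obj ⟶ N, l ≫ e = g := by
  have hP : P.obj.Additive := P.property
  refine exists_lift_of_liftSub (sliceForget X) P e g fun Y m => ?_
  -- Orbits of `X × Y` become objects over `X` by their first projection; the second projection `c
  -- w` maps them to `Y`. A lift `n w` is then chosen freely for each orbit.
  let o (w : ProdOrbit X Y.orb) : Over X := Over.mk (Y := orbitObj w) (X := X) (orbitFst w)
  let c (w : ProdOrbit X Y.orb) : (sliceForget X).obj (o w) ⟶ Y := orbMor (orbitSnd w)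
  choose n hn using fun w => h (op (o w)) (P.obj.map (c w).op m)
  -- Together with the structure map of `s`, a `G`-map `f : s → Y` is a map to `X × Y` and so
  -- factors over an orbit. The uniqueness in `hu` identifies the `G`-maps `s → Y` with the disjoint
  -- union over `w` of the slice morphisms `s → o w`.
  have hf (s : Over X) (f : s.left.toSet →[G] Y.orb.toSet) :
      ∃ q : Σ w, s ⟶ o w, (orbitSnd q.1).comp q.2.left = f := by
    obtain ⟨w, p, h1, h2⟩ := exists_orbit_factor (show s.left.toSet →[G] X.toSet from s.hom) f
    exact ⟨⟨w, Over.homMk p h1⟩, h2⟩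
  choose q hq using hf
  have hu (s : Over X) (w : ProdOrbit X Y.orb) (p : s ⟶ o w) :
      q s ((orbitSnd w).comp p.left) = ⟨w, p⟩ := by
    have h0 := hq s ((orbitSnd w).comp p.left)
    generalize q s ((orbitSnd w).comp p.left) = r at h0
    obtain ⟨w', p'⟩ := r
    have h1 : (⟨w', p'.left⟩ : Σ w : ProdOrbit X Y.orb, s.left.toSet →[G] (orbitObj w).toSet) =
        ⟨w, p.left⟩ := orbit_factor_unique ((Over.w p').trans (Over.w p).symm) h0
    obtain ⟨rfl, h2⟩ := Sigma.mk.inj_iff.mp h1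
    exact congrArg (Sigma.mk w') (Over.OverMorphism.ext (eq_of_heq h2))
  -- The family of lifts is determined by the `n w` through Yoneda, then extended additively to
  -- `ℤ`-combinations in `t'`.
  let t (s : Over X) (f : s.left.toSet →[G] Y.orb.toSet) : N.obj (op s) :=
    N.map (q s f).2.op (n (q s f).1)
  let t' (s : Over X) : ((sliceForget X).obj s ⟶ Y) →+ N.obj (op s) :=
    Finsupp.liftAddHom fun f => zmultiplesHom _ (t s f)
  have ht' (s : Over X) (w : ProdOrbit X Y.orb) (p : s ⟶ o w) :
      t' s ((sliceForget X).map p ≫ c w) = N.map p.op (n w) := by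
    have h1 : t' s (orbMor ((orbitSnd w).comp p.left)) = t s ((orbitSnd w).comp p.left) := by
      exact (Finsupp.liftAddHom_apply_single (fun f => zmultiplesHom _ (t s f)) _ 1).trans
        (one_zsmul _)
    refine (congrArg (t' s) (orbMor_comp (orbitSnd w) p.left).symm).trans (h1.trans ?_)
    simp only [t]
    rw [hu]
  -- Every `G`-map has the form to which `ht'` applies; the two conditions below need only be
  -- checked on such maps, by additivity.
  have ho (s : Over X) (f : ((sliceForget X).obj s).orb.toSet →[G] Y.orb.toSet) :
      ∃ w, ∃ p : s ⟶ o w, orbMap f = (sliceForget X).map p ≫ c w :=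
    ⟨_, (q s f).2, (congrArg orbMor (hq s f).symm).trans (orbMor_comp _ _)⟩
  refine ⟨t', fun s s' p f => ?_, fun s f => ?_⟩
  · dsimp only
    induction f using orbitCat_hom_ind with
    | zero => rw [Limits.comp_zero, map_zero, map_zero, map_zero]
    | sub a b ha hb => rw [Preadditive.comp_sub, map_sub, map_sub, map_sub, ha, hb]
    | of f =>
      obtain ⟨w, p', h1⟩ := ho s' f
      rw [h1, ht', ← Category.assoc, ← Functor.map_comp, ht', op_comp, N.map_comp]
      rfl
  · dsimp only
    induction f using orbitCat_hom_ind with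
    | zero =>
      have h1 : P.obj.map (0 : (sliceForget X).obj s ⟶ Y).op = 0 := P.obj.map_zero _ _
      rw [map_zero, map_zero, h1]
      exact (map_zero (g.app (op s)).hom).symm
    | sub a b ha hb =>
      have h1 : P.obj.map (a - b).op = P.obj.map a.op - P.obj.map b.op := P.obj.map_sub
      rw [map_sub, map_sub, ha, hb, h1]
      exact (map_sub (g.app (op s)).hom _ _).symm
    | of f =>
      obtain ⟨w, p, h1⟩ := ho s f
      rw [h1, ht', op_comp, P.obj.map_comp]
      have h2 := ConcreteCategory.congr_hom (e.naturality p.op) (n w)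
      have h3 := ConcreteCategory.congr_hom (g.naturality p.op)
        (P.obj.map (c w).op m)
      refine h2.trans (Eq.trans ?_ h3.symm)
      exact congrArg (N'.map p.op) (hn w)

end

section

variable {G : Type u} [Group G] {F : FiniteFamily G} {R : Type u} [CommRing R]

/-! ### Contractions after restriction to a slice category -/

theorem constantFunctor_map_orbMap {Y Z : OrbitCat F} (f : Y.orb.toSet →[G] Z.orb.toSet) (r : R) :
    (constantFunctor R F).map (orbMap f).op r = r := by
  have h : (constantFunctor R F).map (orbMap f).op = 𝟙 (ModuleCat.of R R) :=
    (congrArg (· • 𝟙 (ModuleCat.of R R)) (coeffSum_single f 1)).trans (one_smul ℤ _)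
  rw [h]
  rfl

/-- A surjection onto the constant module splits after restriction to a slice category. -/
theorem exists_slice_section (X : Orb F) {P : AddMod R (OrbitCat F)} (ε : P ⟶ constantModule R F)
    (hε : ∀ x, Function.Surjective (ε.hom.app x)) :
    ∃ s : sliceRes X (constantModule R F).obj ⟶ sliceRes X P.obj,
      s ≫ sliceResMap X ε.hom = 𝟙 _ := by
  -- A preimage of `1` at the terminal object of the slice. Its pullbacks `q t` along the structure
  -- maps form a compatible family of preimages of `1`, and the section is `r ↦ r • q t`.
  obtain ⟨p, hp⟩ := hε (op ((Free.embedding ℤ (Orb F)).obj X)) (1 : R)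
  let b (t : Over X) : (sliceForget X).obj t ⟶ (Free.embedding ℤ (Orb F)).obj X :=
    (Free.embedding ℤ (Orb F)).map t.hom
  have hb {t t' : Over X} (α : t ⟶ t') : (sliceForget X).map α ≫ b t' = b t := by
    refine ((Free.embedding ℤ (Orb F)).map_comp _ _).symm.trans ?_
    exact congrArg (fun f => (Free.embedding ℤ (Orb F)).map f) (Over.w α)
  let q (t : Over X) : P.obj.obj (op ((sliceForget X).obj t)) := P.obj.map (b t).op p
  have hq {t t' : Over X} (α : t ⟶ t') : P.obj.map ((sliceForget X).map α).op (q t') = q t := by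
    simp only [q]
    rw [← ModuleCat.comp_apply, ← P.obj.map_comp, ← op_comp, hb]
  have hε (t : Over X) : ε.hom.app (op ((sliceForget X).obj t)) (q t) = (1 : R) := by
    refine (ConcreteCategory.congr_hom (ε.hom.naturality (b t).op) p).trans ?_
    refine (congrArg ((constantFunctor R F).map (b t).op) hp).trans ?_
    exact constantFunctor_map_orbMap _ _
  refine ⟨{ app := fun t => ModuleCat.ofHom (LinearMap.toSpanSingleton R _ (q t.unop))
            naturality := fun t t' α => ?_ }, ?_⟩
  · apply ModuleCat.hom_ext
    apply LinearMap.ext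
    intro (r : R)
    have h1 := constantFunctor_map_orbMap (R := R) (F := F) α.unop.left r
    refine (congrArg (fun v : R => v • q t'.unop) h1).trans ?_
    refine (congrArg (r • ·) (hq α.unop).symm).trans ?_
    exact (map_smul (P.obj.map ((sliceForget X).map α.unop).op).hom r _).symm
  · apply NatTrans.ext
    funext t
    apply ModuleCat.hom_ext
    apply LinearMap.ext
    intro (r : R)
    refine (map_smul (ε.hom.app (op ((sliceForget X).obj t.unop))).hom r (q t.unop)).trans ?_
    exact (congrArg (fun v : R => r * v) (hε t.unop)).trans (mul_one r)

/-- One step of a contraction. The hypothesis on `k` says that `1 - ε ≫ k` is annihilated by `ε`, so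
its values lie in the image of `d`, and the lifting property of the restricted projective gives `l`.
Here `k` is a section of the augmentation at the bottom and the previous homotopy above it. -/
theorem exists_slice_homotopy_zero (X : Orb F) {P P' : AddMod R (OrbitCat F)} [Projective P]
    {M : AddMod R (OrbitCat F)} (d : P' ⟶ P) (ε : P ⟶ M)
    (h : ∀ x, Function.Exact (d.hom.app x) (ε.hom.app x))
    (k : sliceRes X M.obj ⟶ sliceRes X P.obj)
    (hk : sliceResMap X ε.hom ≫ k ≫ sliceResMap X ε.hom = sliceResMap X ε.hom) :
    ∃ l : sliceRes X P.obj ⟶ sliceRes X P'.obj,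
      l ≫ sliceResMap X d.hom + sliceResMap X ε.hom ≫ k = 𝟙 _ := by
  obtain ⟨l, hl⟩ := exists_slice_lift X P (sliceResMap X d.hom)
    (𝟙 _ - sliceResMap X ε.hom ≫ k) fun s m => (h _ _).mp (by
      have h1 : (𝟙 _ - sliceResMap X ε.hom ≫ k) ≫ sliceResMap X ε.hom = 0 := by
        rw [Preadditive.sub_comp, Category.id_comp, Category.assoc, hk, sub_self]
      exact congrArg (fun a => a.app s m) h1)
  exact ⟨l, by rw [hl, sub_add_cancel]⟩

/-- A resolution of the constant module by projective modules is contractible after restriction to a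
slice category. -/
theorem exists_slice_homotopy (X : Orb F) {P : ChainComplex (AddMod R (OrbitCat F)) ℕ}
    {ε : P.X 0 ⟶ constantModule R F} (h : IsProjectiveResolution P ε) (n : ℕ) :
    ∃ (k : sliceRes X (P.X n).obj ⟶ sliceRes X (P.X (n + 1)).obj)
      (l : sliceRes X (P.X (n + 1)).obj ⟶ sliceRes X (P.X (n + 2)).obj),
      l ≫ sliceResMap X (P.d (n + 2) (n + 1)).hom + sliceResMap X (P.d (n + 1) n).hom ≫ k =
        𝟙 _ := by
  have := h.projective
  -- The induction carries only `d ≫ k ≫ d = d`; this is weaker than the homotopy identity but is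
  -- exactly what the next step consumes.
  suffices hk : ∃ k : sliceRes X (P.X n).obj ⟶ sliceRes X (P.X (n + 1)).obj,
      sliceResMap X (P.d (n + 1) n).hom ≫ k ≫ sliceResMap X (P.d (n + 1) n).hom =
        sliceResMap X (P.d (n + 1) n).hom by
    obtain ⟨k, hk⟩ := hk
    exact ⟨k, exists_slice_homotopy_zero X _ _ (h.exact_succ n) k hk⟩
  induction n with
  | zero =>
    obtain ⟨s, hs⟩ := exists_slice_section X ε h.surjective
    obtain ⟨l, hl⟩ := exists_slice_homotopy_zero X _ _ h.exact_zero s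
      (by rw [hs, Category.comp_id])
    have h0 : sliceResMap X (P.d 1 0).hom ≫ sliceResMap X ε.hom = 0 := by
      apply NatTrans.ext
      funext t
      apply ModuleCat.hom_ext
      apply LinearMap.ext
      intro m
      exact (h.exact_zero _ _).mpr ⟨m, rfl⟩
    refine ⟨l, ?_⟩
    -- Composing `l ≫ d = 1 - ε ≫ s` with `d` in front removes the last term because `d ≫ ε = 0`,
    -- leaving `d ≫ l ≫ d = d`. The successor case is the same with `d` for `ε`.
    rw [← eq_sub_iff_add_eq] at hl
    rw [hl, Preadditive.comp_sub, ← Category.assoc, h0, Limits.zero_comp, sub_zero,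
      Category.comp_id]
  | succ n ih =>
    obtain ⟨k, hk⟩ := ih
    obtain ⟨l, hl⟩ := exists_slice_homotopy_zero X _ _ (h.exact_succ n) k hk
    have h0 : sliceResMap X (P.d (n + 2) (n + 1)).hom ≫ sliceResMap X (P.d (n + 1) n).hom = 0 := by
      apply NatTrans.ext
      funext t
      apply ModuleCat.hom_ext
      apply LinearMap.ext
      intro m
      exact (h.exact_succ n _ _).mpr ⟨m, rfl⟩
    refine ⟨l, ?_⟩
    rw [← eq_sub_iff_add_eq] at hl
    rw [hl, Preadditive.comp_sub, ← Category.assoc, h0, Limits.zero_comp, sub_zero,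
      Category.comp_id]

/-- The section `k` exists only over the slice, so a preimage is found by passing to the slice
tensor product, applying `k`, and coming back. -/
theorem ctmap_hecke_surjective (X : Orb F) {M M' : AddMod R (OrbitCat F)} (f : M ⟶ M')
    (k : sliceRes X M'.obj ⟶ sliceRes X M.obj) (hk : k ≫ sliceResMap X f.hom = 𝟙 _) :
    Function.Surjective (ctmap f.hom (𝟙 (heckeFrom R X))) := by
  intro t
  refine ⟨ofSlice X M.obj (sliceTensorMap X k (toSlice X M' t)), ?_⟩
  rw [← ofSlice_naturality, ← sliceTensorMap_comp, hk, sliceTensorMap_id, ofSlice_toSlice]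

/-- A homotopy over the slice gives exactness of the slice tensor products; the retraction carries
it to the orbit category, using naturality of `toSlice` on the way in and of `ofSlice` on the way
out. -/
theorem ctmap_hecke_exact (X : Orb F) {M M' M'' : AddMod R (OrbitCat F)} (f : M ⟶ M')
    (g : M' ⟶ M'') (hfg : f ≫ g = 0) (l : sliceRes X M'.obj ⟶ sliceRes X M.obj)
    (k : sliceRes X M''.obj ⟶ sliceRes X M'.obj)
    (hlk : l ≫ sliceResMap X f.hom + sliceResMap X g.hom ≫ k = 𝟙 _) :
    Function.Exact (ctmap f.hom (𝟙 (heckeFrom R X))) (ctmap g.hom (𝟙 (heckeFrom R X))) := by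
  intro t
  constructor
  · intro ht
    refine ⟨ofSlice X M.obj (sliceTensorMap X l (toSlice X M' t)), ?_⟩
    -- The `k`-part of the homotopy sees `t` only through its image under `g`, which is zero.
    have h1 : sliceTensorMap X (sliceResMap X g.hom ≫ k) (toSlice X M' t) = 0 := by
      rw [sliceTensorMap_comp, ← toSlice_naturality, ht, map_zero, map_zero]
    have h2 : sliceTensorMap X (l ≫ sliceResMap X f.hom + sliceResMap X g.hom ≫ k)
        (toSlice X M' t) = toSlice X M' t := by
      rw [hlk, sliceTensorMap_id]
    rw [sliceTensorMap_add, h1, add_zero, sliceTensorMap_comp] at h2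
    rw [← ofSlice_naturality, h2, ofSlice_toSlice]
  · rintro ⟨s, rfl⟩
    have h0 : ctmap (f.hom ≫ g.hom) (𝟙 (heckeFrom R X)) = 0 := by
      have h1 : f.hom ≫ g.hom = 0 := congrArg (fun a => a.hom) hfg
      rw [h1]
      refine catTensor_ext fun Y m φ => ?_
      rw [ctmap_ctmul]
      exact LinearMap.map_zero₂ (ctmulHom _ _ Y) φ
    rw [← LinearMap.comp_apply, ← ctmap_comp, Category.comp_id, h0]
    rfl

end

section

variable {G : Type u} [Group G] {F : FiniteFamily G} {R : Type u} [CommRing R]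

/-! ### The module induced from the constant module -/

/-- The augmentation `R[S] → R`. -/
noncomputable def augmentation (R : Type u) [CommRing R] (S : Type u) : MonoidAlgebra R S →ₗ[R] R :=
  extend fun _ => 1

theorem augmentation_single {S : Type u} (s : S) : augmentation R S (MonoidAlgebra.single s 1) = 1 := by
  rw [augmentation, extend_single, one_smul]

theorem augmentation_smul {S : Type u} [MulAction G S] (g : G) (v : MonoidAlgebra R S) :
    augmentation R S (Representation.ofMulAction R G S g v) = augmentation R S v := by
  refine LinearMap.congr_fun (f := augmentation R S ∘ₗ Representation.ofMulAction R G S g)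
    (perm_ext fun s => ?_) v
  rw [LinearMap.comp_apply, Representation.ofMulAction_single, augmentation_single,
    augmentation_single]

/-- The augmentation of the image of the base coset under a morphism of the Hecke category. -/
noncomputable def degree (X Y : Orb F) : ((⟨X⟩ : HeckeCat R F) ⟶ ⟨Y⟩) →ₗ[R] R :=
  augmentation R Y.toSet ∘ₗ heckeLin.flip (baseCoset R X)

/-- All points of `X` are translates of the base coset and the augmentation is invariant, so every
point has an image of the same augmentation. Multiplicativity of the degree follows. -/
theorem augmentation_heckeLin {X Y : Orb F} (φ : (⟨X⟩ : HeckeCat R F) ⟶ ⟨Y⟩)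
    (v : MonoidAlgebra R X.toSet) :
    augmentation R Y.toSet (heckeLin φ v) = augmentation R X.toSet v * degree X Y φ := by
  refine LinearMap.congr_fun (f := augmentation R Y.toSet ∘ₗ heckeLin φ)
    (g := (LinearMap.mulRight R (degree X Y φ)) ∘ₗ augmentation R X.toSet) (perm_ext fun x => ?_) v
  rw [LinearMap.comp_apply, LinearMap.comp_apply, augmentation_single, LinearMap.mulRight_apply,
    one_mul]
  obtain ⟨g, rfl⟩ := QuotientGroup.mk_surjective x
  have h : MonoidAlgebra.single ((g : G) : G ⧸ X.H) (1 : R) =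
      Representation.ofMulAction R G X.toSet g (baseCoset R X) := by
    rw [baseCoset, Representation.ofMulAction_single]
    simp
  rw [h, heckeLin_smul, augmentation_smul]
  rfl

theorem degree_comp {X Y Z : Orb F} (φ : (⟨X⟩ : HeckeCat R F) ⟶ ⟨Y⟩)
    (ψ : (⟨Y⟩ : HeckeCat R F) ⟶ ⟨Z⟩) : degree X Z (φ ≫ ψ) = degree X Y φ * degree Y Z ψ :=
  augmentation_heckeLin ψ _

theorem degree_push {X Y : Orb F} (f : X.toSet →[G] Y.toSet) : degree X Y (push R f) = 1 := by
  change augmentation R Y.toSet (heckeLin (push R f) (MonoidAlgebra.single _ 1)) = 1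
  rw [heckeLin_push, augmentation_single]

theorem transfer_id (X : Orb F) :
    transfer R (MulActionHom.id G : X.toSet →[G] X.toSet) = 𝟙 _ :=
  hecke_ext R (perm_ext fun x => Span.linear_ofMap R (MulActionHom.id G) x)

theorem degree_id (X : Orb F) : degree X X (𝟙 (⟨X⟩ : HeckeCat R F)) = 1 := by
  rw [← push_id, degree_push]

variable (R) in
/-- The degree as a linear map on `[X, Y]`. -/
noncomputable def degreeHom (X : Orb F) (Y : OrbitCat F) : (heckeFrom R X).obj Y →ₗ[R] R :=
  degree X Y.orb

theorem degreeHom_orbMap {X : Orb F} {Y Z : OrbitCat F} (f : Y.orb.toSet →[G] Z.orb.toSet)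
    (φ : (heckeFrom R X).obj Y) :
    degreeHom R X Z ((heckeFrom R X).map (orbMap f) φ) = degreeHom R X Y φ := by
  refine (degree_comp (X := X) (Y := Y.orb) (Z := Z.orb) φ (push R f)).trans ?_
  rw [degree_push, mul_one]
  rfl

/-- The action of a morphism of the orbit category on the constant module. -/
noncomputable def constAct {Y Z : OrbitCat F} (α : Y ⟶ Z) : R →ₗ[R] R :=
  ((constantFunctor R F).map α.op).hom

theorem constAct_orbMap {Y Z : OrbitCat F} (f : Y.orb.toSet →[G] Z.orb.toSet) (r : R) :
    constAct (orbMap f) r = r :=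
  constantFunctor_map_orbMap f r

/-- The balance condition for `r ⊗ φ ↦ r deg(φ)`. By additivity it reduces to `G`-maps, which act as
the identity on `R` and preserve the degree. -/
theorem constAct_mul_degreeHom {X : Orb F} {Y Z : OrbitCat F} (α : Y ⟶ Z) (r : R)
    (φ : (heckeFrom R X).obj Y) : constAct α r * degreeHom R X Y φ =
      r * degreeHom R X Z ((heckeFrom R X).map α φ) := by
  have hM : (constantFunctor R F).Additive := (constantModule R F).property
  induction α using orbitCat_hom_ind with
  | zero =>
    have h : (constantFunctor R F).map (0 : Y ⟶ Z).op = 0 := (constantFunctor R F).map_zero _ _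
    rw [heckeFrom_map_zero, map_zero, mul_zero, constAct, h]
    exact zero_mul _
  | sub a b ha hb =>
    have h : (constantFunctor R F).map (a - b).op = (constantFunctor R F).map a.op -
      (constantFunctor R F).map b.op := (constantFunctor R F).map_sub
    rw [heckeFrom_map_sub, map_sub, mul_sub, ← ha, ← hb, constAct, h]
    exact sub_mul _ _ _
  | of f => rw [degreeHom_orbMap, constAct_orbMap]

/-- The class of `r ⊗ φ` in the tensor product with the constant module. -/
noncomputable def constTmul (X : Orb F) (Y : OrbitCat F) : R →ₗ[R] (heckeFrom R X).obj Y →ₗ[R]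
    CatTensor (constantFunctor R F) (heckeFrom R X) :=
  ctmulHom (constantFunctor R F) (heckeFrom R X) Y

theorem constTensor_ext {X : Orb F} {V : Type*} [AddCommGroup V] [Module R V]
    {f g : CatTensor (constantFunctor R F) (heckeFrom R X) →ₗ[R] V}
    (h : ∀ Y r φ, f (constTmul X Y r φ) = g (constTmul X Y r φ)) : f = g :=
  catTensor_ext h

/-- The bilinear map `(r, φ) ↦ r deg(φ)`. -/
noncomputable def constPairing (X : Orb F) (Y : OrbitCat F) :
    R →ₗ[R] (heckeFrom R X).obj Y →ₗ[R] R :=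
  (LinearMap.mul R R).compl₂ (degreeHom R X Y)

/-- The linear map `r ⊗ φ ↦ r deg(φ)`. -/
noncomputable def constTensorHom (X : Orb F) :
    CatTensor (constantFunctor R F) (heckeFrom R X) →ₗ[R] R :=
  ctlift (constPairing X) fun _ _ => constAct_mul_degreeHom (R := R)

theorem constTensorHom_constTmul (X : Orb F) (Y : OrbitCat F) (r : R)
    (φ : (heckeFrom R X).obj Y) :
    constTensorHom X (constTmul X Y r φ) = r * degreeHom R X Y φ :=
  ctlift_ctmul _ _ _ _ _

variable (R) in
/-- The identity as an element of `[X, X]`. -/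
noncomputable def idElt (X : Orb F) : (heckeFrom R X).obj ((Free.embedding ℤ (Orb F)).obj X) :=
  𝟙 (⟨X⟩ : HeckeCat R F)

theorem degreeHom_idElt (X : Orb F) : degreeHom R X _ (idElt R X) = 1 := degree_id X

theorem transferElt_id (X : Orb F) :
    transferElt R (MulActionHom.id G : X.toSet →[G] X.toSet) = idElt R X :=
  transfer_id X

theorem degreeHom_orbMor {X Z : Orb F} {Y : OrbitCat F} (b : Z.toSet →[G] Y.orb.toSet)
    (φ : (heckeFrom R X).obj ((Free.embedding ℤ (Orb F)).obj Z)) :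
    degreeHom R X Y ((heckeFrom R X).map (orbMor b) φ) = degreeHom R X _ φ :=
  degreeHom_orbMap _ _

theorem constTmul_orbMor {X Z : Orb F} {Y : OrbitCat F} (b : Z.toSet →[G] Y.orb.toSet) (r : R)
    (φ : (heckeFrom R X).obj ((Free.embedding ℤ (Orb F)).obj Z)) :
    constTmul X Y r ((heckeFrom R X).map (orbMor b) φ) = constTmul X _ r φ :=
  (ctmul_map (constantFunctor R F) (heckeFrom R X) (orbMor b) r φ).symm.trans
    (congrArg (fun v : R => constTmul X _ v φ) (constantFunctor_map_orbMap _ r))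

/-- `G`-maps act trivially on the constant module, so pushing along them does not change a tensor.
For legs `(a, b)` this gives `r ⊗ b_* tr(a) = r ⊗ tr(a) = r ⊗ a_* tr(a)`, and `a_* tr(a)` is a
multiple of the identity of `X`. -/
theorem constTmul_eq {X : Orb F} {Y : OrbitCat F} (r : R) (φ : (heckeFrom R X).obj Y) :
    constTmul X Y r φ = degreeHom R X Y φ • constTmul X _ r (idElt R X) := by
  refine LinearMap.congr_fun (f := constTmul X Y r)
    (g := (degreeHom R X Y).smulRight (constTmul X _ r (idElt R X)))
    (heckeFrom_ext fun w => ?_) φ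
  obtain ⟨d, hd⟩ : ∃ d : R, (heckeFrom R X).map
      (orbMor (Y := (Free.embedding ℤ (Orb F)).obj X) (orbitFst w)) (transferElt R (orbitFst w)) =
        d • idElt R X := by
    rw [← transferElt_id]
    exact exists_transferElt_map R (MulActionHom.id G : X.toSet →[G] X.toSet) (orbitFst w)
  -- Pushing preserves degree and the identity has degree `1`, so the multiple is the degree of the
  -- transfer.
  have hdeg : degreeHom R X _ (transferElt R (orbitFst w)) = d := by
    rw [← degreeHom_orbMor (Y := (Free.embedding ℤ (Orb F)).obj X) (orbitFst w), hd, map_smul,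
      degreeHom_idElt, smul_eq_mul, mul_one]
  rw [LinearMap.smulRight_apply, degreeHom_orbMor, hdeg, constTmul_orbMor,
    ← constTmul_orbMor (Y := (Free.embedding ℤ (Orb F)).obj X) (orbitFst w), hd, map_smul]

/-- The value at `X` of the module induced from the constant module. -/
noncomputable def constTensorEquiv (X : Orb F) :
    CatTensor (constantFunctor R F) (heckeFrom R X) ≃ₗ[R] R :=
  LinearEquiv.ofLinearMap (constTensorHom X) ((constTmul X _).flip (idElt R X))
    (by
      ext
      rw [LinearMap.comp_apply, LinearMap.flip_apply, constTensorHom_constTmul, degreeHom_idElt,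
        mul_one, LinearMap.id_apply])
    (by
      refine constTensor_ext fun Y r φ => ?_
      rw [LinearMap.comp_apply, LinearMap.flip_apply, constTensorHom_constTmul,
        LinearMap.id_apply, constTmul_eq r φ, mul_comm, ← smul_eq_mul, map_smul,
        LinearMap.smul_apply])

/-- Every element of the trivial module is fixed. -/
def trivialFixedEquiv (H : Subgroup G) : R ≃ₗ[R] fixedBy R (Rep.trivial R G R) H where
  toFun r := ⟨r, fun _ _ => rfl⟩
  invFun m := m.1
  map_add' _ _ := rfl
  map_smul' _ _ := rfl
  left_inv _ := rfl
  right_inv _ := rfl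

theorem orbitLin_trivial {H : Subgroup G} (m : fixedBy R (Rep.trivial R G R) H)
    (v : MonoidAlgebra R (G ⧸ H)) : orbitLin m v = augmentation R (G ⧸ H) v * m.1 := by
  refine LinearMap.congr_fun (f := orbitLin m)
    (g := LinearMap.mulRight R (A := R) m.1 ∘ₗ augmentation R (G ⧸ H)) (perm_ext fun x => ?_) v
  rw [LinearMap.comp_apply, augmentation_single, LinearMap.mulRight_apply, one_mul, orbitLin,
    extend_single, one_smul]
  induction x using Quotient.inductionOn with
  | h g => rfl

variable (R F) in
/-- The isomorphism between the module induced from the constant module and the fixed point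
module of the trivial module. -/
noncomputable def indConstantIso :
    (ind R (sigma F ⋙ pi R F)).obj (constantModule R F) ≅
      fixedPointModule F (Rep.trivial R G R) :=
  (isLinear R (HeckeCat R F)).isoMk (NatIso.ofComponents
    (fun x => LinearEquiv.toModuleIso
      ((constTensorEquiv x.unop.orb).trans (trivialFixedEquiv x.unop.orb.H))) (by
    intro x y φ
    apply ModuleCat.hom_ext
    refine constTensor_ext fun Y r ψ => Subtype.ext ?_
    have h1 : ctmap (𝟙 (constantFunctor R F)) ((homFrom R (sigma F ⋙ pi R F)).map φ)
        (constTmul x.unop.orb Y r ψ) = constTmul y.unop.orb Y r (φ.unop ≫ ψ) :=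
      ctmap_ctmul _ _ _ _ _
    -- The left side is `r deg(φ ≫ ψ)`. On the right, `φ` acts on the trivial module as
    -- multiplication by its own degree, so naturality is multiplicativity of the degree.
    change constTensorHom _ (ctmap (𝟙 (constantFunctor R F))
      ((homFrom R (sigma F ⋙ pi R F)).map φ) (constTmul x.unop.orb Y r ψ)) =
        orbitLin (trivialFixedEquiv _ (constTensorHom _ (constTmul x.unop.orb Y r ψ)))
          (heckeLin φ.unop (baseCoset R y.unop.orb))
    rw [h1]
    refine (constTensorHom_constTmul _ Y r _).trans ?_
    rw [constTensorHom_constTmul, orbitLin_trivial]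
    refine (congrArg (r * ·) (degree_comp (Z := Y.orb) φ.unop ψ)).trans ?_
    exact mul_left_comm _ _ _))

end

section

/-! ### Induction preserves projective modules -/

section Projective

variable {R : Type u} [CommRing R] {C D : Type u} [Category.{u} C] [Preadditive C]
  [Category.{u} D] [Preadditive D] [Linear R D]

theorem linMod_map_smul (N : LinMod R D) {x y : D} (r : R) (f : x ⟶ y) (n : N.obj.obj (op y)) :
    N.obj.map (r • f).op n = r • N.obj.map f.op n := by
  rw [N.property.2]
  rfl

theorem linMod_map_add (N : LinMod R D) {x y : D} (f g : x ⟶ y) (n : N.obj.obj (op y)) :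
    N.obj.map (f + g).op n = N.obj.map f.op n + N.obj.map g.op n :=
  ConcreteCategory.congr_hom (N.property.1.map_add (f := f.op) (g := g.op)) n

/-- The pointwise cokernel of a morphism of linear modules. -/
noncomputable def linCoker {N N' : LinMod R D} (e : N ⟶ N') : LinMod R D where
  obj :=
    { obj := fun d => ModuleCat.of R (N'.obj.obj d ⧸ LinearMap.range (e.hom.app d).hom)
      map := fun {d d'} f => ModuleCat.ofHom (Submodule.mapQ _ _ (N'.obj.map f).hom (by
        rintro _ ⟨n, rfl⟩
        exact ⟨N.obj.map f n, ConcreteCategory.congr_hom (e.hom.naturality f) n⟩))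
      map_id := fun d => by
        apply ModuleCat.hom_ext
        apply Submodule.linearMap_qext
        ext n
        exact congrArg (Submodule.Quotient.mk) (ConcreteCategory.congr_hom (N'.obj.map_id d) n)
      map_comp := fun f g => by
        apply ModuleCat.hom_ext
        apply Submodule.linearMap_qext
        ext n
        exact congrArg (Submodule.Quotient.mk)
          (ConcreteCategory.congr_hom (N'.obj.map_comp f g) n) }
  property := by
    refine ⟨⟨fun {d d' f g} => ?_⟩, fun x y r f => ?_⟩
    · apply ModuleCat.hom_ext
      apply Submodule.linearMap_qext
      ext n
      exact congrArg (Submodule.Quotient.mk) (linMod_map_add N' f.unop g.unop n)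
    · apply ModuleCat.hom_ext
      apply Submodule.linearMap_qext
      ext n
      exact congrArg (Submodule.Quotient.mk) (linMod_map_smul N' r f n)

/-- The projection to the pointwise cokernel. -/
noncomputable def linCokerProj {N N' : LinMod R D} (e : N ⟶ N') : N' ⟶ linCoker e :=
  ObjectProperty.homMk
    { app := fun d => ModuleCat.ofHom (LinearMap.range (e.hom.app d).hom).mkQ
      naturality := fun _ _ _ => rfl }

/-- Epimorphisms of linear modules are surjective at every object. -/
theorem surjective_of_epi {N N' : LinMod R D} (e : N ⟶ N') [Epi e] (d : Dᵒᵖ) :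
    Function.Surjective (e.hom.app d) := by
  have h0 (N : LinMod R D) (a : N' ⟶ N) (n) : (0 : N' ⟶ N).hom.app d n = 0 := rfl
  -- An epimorphism has zero cokernel projection, and the cokernel is formed pointwise.
  have h : e ≫ linCokerProj e = e ≫ 0 := by
    apply ObjectProperty.hom_ext
    apply NatTrans.ext
    funext x
    apply ModuleCat.hom_ext
    apply LinearMap.ext
    intro n
    exact (Submodule.Quotient.mk_eq_zero _).mpr ⟨n, rfl⟩
  intro n
  have h1 := congrArg (fun a => a.hom.app d n) (Epi.left_cancellation _ _ h)
  exact (Submodule.Quotient.mk_eq_zero _).mp h1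

variable (ι : C ⥤ D) [ι.Additive]

/-- Restriction of linear modules along a functor. -/
def linRes (N : LinMod R D) : AddMod R C where
  obj := ι.op ⋙ N.obj
  property := ⟨fun {_ _ f g} =>
    (congrArg (fun k => N.obj.map (Quiver.Hom.op k)) (ι.map_add (f := f.unop) (g := g.unop))).trans
      (N.property.1.map_add (f := (ι.map f.unop).op) (g := (ι.map g.unop).op))⟩

/-- Restriction of morphisms of linear modules along a functor. -/
def linResMap {N N' : LinMod R D} (e : N ⟶ N') : linRes ι N ⟶ linRes ι N' :=
  ObjectProperty.homMk (Functor.whiskerLeft ι.op e.hom)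

/-- The morphism `P → Res N` adjoint to a morphism `Ind P → N`. -/
noncomputable def indToRes {P : AddMod R C} {N : LinMod R D} (f : (ind R ι).obj P ⟶ N) :
    P ⟶ linRes ι N :=
  ObjectProperty.homMk
    { app := fun c => ModuleCat.ofHom ((f.hom.app (op (ι.obj c.unop))).hom ∘ₗ
        (ctmulHom P.obj ((homFrom R ι).obj (op (ι.obj c.unop))) c.unop).flip
          (show ι.obj c.unop ⟶ ι.obj c.unop from 𝟙 _))
      naturality := fun c c' α => by
        apply ModuleCat.hom_ext
        apply LinearMap.ext
        intro m
        have h1 := ctmul_map P.obj ((homFrom R ι).obj (op (ι.obj c'.unop))) α.unop m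
          (show ι.obj c'.unop ⟶ ι.obj c'.unop from 𝟙 _)
        have h2 := ConcreteCategory.congr_hom (f.hom.naturality (ι.map α.unop).op)
          (ctmul P.obj ((homFrom R ι).obj (op (ι.obj c.unop))) c.unop m
            (show ι.obj c.unop ⟶ ι.obj c.unop from 𝟙 _))
        refine (congrArg (f.hom.app (op (ι.obj c'.unop))) h1).trans (Eq.trans ?_ h2)
        refine congrArg (f.hom.app (op (ι.obj c'.unop))) ?_
        refine Eq.trans ?_ (ctmap_ctmul _ _ _ _ _).symm
        refine congrArg (ctmul P.obj ((homFrom R ι).obj (op (ι.obj c'.unop))) c.unop m) ?_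
        exact (Category.id_comp (ι.map α.unop)).trans (Category.comp_id (ι.map α.unop)).symm }

/-- The bilinear map `(m, φ) ↦ φ^* l(m)`. -/
noncomputable def resPairing {P : AddMod R C} {N : LinMod R D} (l : P ⟶ linRes ι N) (d : D)
    (c : C) : P.obj.obj (op c) →ₗ[R] ((homFrom R ι).obj (op d)).obj c →ₗ[R] N.obj.obj (op d) :=
  LinearMap.mk₂ R (fun m (φ : d ⟶ ι.obj c) => N.obj.map φ.op (l.hom.app (op c) m))
    (fun m m' φ => by rw [map_add]; exact map_add (N.obj.map φ.op).hom _ _)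
    (fun r m φ => by rw [map_smul]; exact map_smul (N.obj.map φ.op).hom _ _)
    (fun m φ φ' => linMod_map_add N _ _ _)
    (fun r m φ => linMod_map_smul N _ _ _)

/-- The linear map `m ⊗ φ ↦ φ^* l(m)`. -/
noncomputable def resTensorHom {P : AddMod R C} {N : LinMod R D} (l : P ⟶ linRes ι N) (d : D) :
    CatTensor P.obj ((homFrom R ι).obj (op d)) →ₗ[R] N.obj.obj (op d) :=
  ctlift (resPairing ι l d) fun c c' α m φ => by
    change N.obj.map (show d ⟶ ι.obj c from φ).op (l.hom.app (op c) (P.obj.map α.op m)) =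
      N.obj.map ((show d ⟶ ι.obj c from φ) ≫ ι.map α).op (l.hom.app (op c') m)
    rw [op_comp, N.obj.map_comp]
    exact congrArg (N.obj.map _) (ConcreteCategory.congr_hom (l.hom.naturality α.op) m)

theorem resTensorHom_ctmul {P : AddMod R C} {N : LinMod R D} (l : P ⟶ linRes ι N) {d : D} {c : C}
    (m : P.obj.obj (op c)) (φ : d ⟶ ι.obj c) :
    resTensorHom ι l d (ctmul P.obj ((homFrom R ι).obj (op d)) c m φ) =
      N.obj.map φ.op (l.hom.app (op c) m) :=
  ctlift_ctmul _ _ _ _ _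

/-- The morphism `Ind P → N` adjoint to a morphism `P → Res N`. -/
noncomputable def resToInd {P : AddMod R C} {N : LinMod R D} (l : P ⟶ linRes ι N) :
    (ind R ι).obj P ⟶ N :=
  ObjectProperty.homMk
    { app := fun d => ModuleCat.ofHom (resTensorHom ι l d.unop)
      naturality := fun d d' f => by
        apply ModuleCat.hom_ext
        refine catTensor_ext fun c m φ => ?_
        let φ' : d.unop ⟶ ι.obj c := φ
        have h1 := ctmap_ctmul (𝟙 P.obj) ((homFrom R ι).map f) c m φ
        refine (congrArg (resTensorHom ι l d'.unop) h1).trans ?_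
        refine (resTensorHom_ctmul ι l m (f.unop ≫ φ')).trans ?_
        refine Eq.trans ?_ (congrArg (N.obj.map f) (resTensorHom_ctmul ι l m φ').symm)
        rw [op_comp, N.obj.map_comp]
        rfl }

/-- Every generator satisfies `m ⊗ φ = φ^*(m ⊗ id)`, so `f` is determined by `m ↦ f(m ⊗ id)`, and
lifting that map along the restriction of `e` lifts `f`. This is the part of the adjunction needed
for projectivity. -/
theorem resToInd_comp {P : AddMod R C} {N N' : LinMod R D} (f : (ind R ι).obj P ⟶ N')
    (e : N ⟶ N') (l : P ⟶ linRes ι N) (h : l ≫ linResMap ι e = indToRes ι f) :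
    resToInd ι l ≫ e = f := by
  apply ObjectProperty.hom_ext
  apply NatTrans.ext
  funext d
  apply ModuleCat.hom_ext
  refine catTensor_ext fun c m φ => ?_
  let φ' : d.unop ⟶ ι.obj c := φ
  refine (congrArg (e.hom.app d) (resTensorHom_ctmul ι l m φ')).trans ?_
  refine (ConcreteCategory.congr_hom (e.hom.naturality φ'.op) _).trans ?_
  have h1 : e.hom.app (op (ι.obj c)) (l.hom.app (op c) m) = (indToRes ι f).hom.app (op c) m :=
    congrArg (fun a => a.hom.app (op c) m) h
  refine (congrArg (N'.obj.map φ'.op) h1).trans ?_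
  refine (ConcreteCategory.congr_hom (f.hom.naturality φ'.op) _).symm.trans ?_
  refine congrArg (f.hom.app d) ?_
  refine (ctmap_ctmul _ _ _ _ _).trans ?_
  refine congrArg (ctmul P.obj ((homFrom R ι).obj d) c m) ?_
  exact Category.comp_id φ'

/-- Induction preserves projective modules. -/
theorem projective_ind (P : AddMod R C) [Projective P] : Projective ((ind R ι).obj P) := by
  refine ⟨fun {E X} f e _ => ?_⟩
  -- Epimorphisms are pointwise surjections, a property that restriction visibly keeps.
  have : Epi (linResMap ι e) := epi_of_surjective _ fun c => surjective_of_epi e _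
  exact ⟨resToInd ι (Projective.factorThru (indToRes ι f) (linResMap ι e)),
    resToInd_comp ι f e _ (Projective.factorThru_comp _ _)⟩

end Projective

/-! ### Assembly of the induced resolution. -/

variable {G : Type u} [Group G] {F : FiniteFamily G} {R : Type u} [CommRing R]

theorem ind_map_surjective (X : Orb F) {M M' : AddMod R (OrbitCat F)} (f : M ⟶ M')
    (k : sliceRes X M'.obj ⟶ sliceRes X M.obj) (hk : k ≫ sliceResMap X f.hom = 𝟙 _) :
    Function.Surjective (((ind R (sigma F ⋙ pi R F)).map f).hom.app (op ⟨X⟩)) :=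
  ctmap_hecke_surjective X f k hk

theorem ind_map_exact (X : Orb F) {M M' M'' : AddMod R (OrbitCat F)} (f : M ⟶ M') (g : M' ⟶ M'')
    (hfg : f ≫ g = 0) (l : sliceRes X M'.obj ⟶ sliceRes X M.obj)
    (k : sliceRes X M''.obj ⟶ sliceRes X M'.obj)
    (hlk : l ≫ sliceResMap X f.hom + sliceResMap X g.hom ≫ k = 𝟙 _) :
    Function.Exact (((ind R (sigma F ⋙ pi R F)).map f).hom.app (op ⟨X⟩))
      (((ind R (sigma F ⋙ pi R F)).map g).hom.app (op ⟨X⟩)) :=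
  ctmap_hecke_exact X f g hfg l k hlk

theorem isoApp_bijective {C : Type u} [Category.{u} C]
    {W : ObjectProperty (Cᵒᵖ ⥤ ModuleCat.{u} R)} {N N' : W.FullSubcategory} (θ : N ≅ N')
    (x : Cᵒᵖ) : Function.Bijective (θ.hom.hom.app x) := by
  refine Function.bijective_iff_has_inverse.mpr ⟨θ.inv.hom.app x, fun n => ?_, fun n => ?_⟩
  · exact congrArg (fun a => a.hom.app x n) θ.hom_inv_id
  · exact congrArg (fun a => a.hom.app x n) θ.inv_hom_id

theorem surjective_comp_iso {C : Type u} [Category.{u} C]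
    {W : ObjectProperty (Cᵒᵖ ⥤ ModuleCat.{u} R)} {M N N' : W.FullSubcategory} (f : M ⟶ N)
    (θ : N ≅ N') (x : Cᵒᵖ) (h : Function.Surjective (f.hom.app x)) :
    Function.Surjective ((f ≫ θ.hom).hom.app x) :=
  (isoApp_bijective θ x).surjective.comp h

theorem exact_comp_iso {C : Type u} [Category.{u} C]
    {W : ObjectProperty (Cᵒᵖ ⥤ ModuleCat.{u} R)} {L M N N' : W.FullSubcategory} (f : L ⟶ M)
    (g : M ⟶ N) (θ : N ≅ N') (x : Cᵒᵖ) (h : Function.Exact (f.hom.app x) (g.hom.app x)) :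
    Function.Exact (f.hom.app x) ((g ≫ θ.hom).hom.app x) := fun t =>
  (map_eq_zero_iff (θ.hom.hom.app x).hom (isoApp_bijective θ x).injective).trans (h t)

/-- Induction to the Hecke category sends projective resolutions of the constant module to
projective resolutions of the fixed point module of the trivial module. -/
theorem isProjectiveResolution_ind {P : ChainComplex (AddMod R (OrbitCat F)) ℕ}
    {ε : P.X 0 ⟶ constantModule R F} (h : IsProjectiveResolution P ε)
    {N : LinMod R (HeckeCat R F)}
    (θ : (ind R (sigma F ⋙ pi R F)).obj (constantModule R F) ≅ N) :
    IsProjectiveResolution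
      (((ind R (sigma F ⋙ pi R F)).mapHomologicalComplex (ComplexShape.down ℕ)).obj P)
      ((ind R (sigma F ⋙ pi R F)).map ε ≫ θ.hom) := by
  have := h.projective
  refine ⟨fun n => projective_ind _ (P.X n), fun ⟨⟨X⟩⟩ => ?_, fun ⟨⟨X⟩⟩ => ?_,
    fun n ⟨⟨X⟩⟩ => ?_⟩
  · obtain ⟨s, hs⟩ := exists_slice_section X ε h.surjective
    exact surjective_comp_iso _ θ _ (ind_map_surjective X ε s hs)
  · obtain ⟨s, hs⟩ := exists_slice_section X ε h.surjective
    obtain ⟨l, hl⟩ := exists_slice_homotopy_zero X _ _ h.exact_zero s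
      (by rw [hs, Category.comp_id])
    have h0 : P.d 1 0 ≫ ε = 0 := by
      apply ObjectProperty.hom_ext
      apply NatTrans.ext
      funext y
      apply ModuleCat.hom_ext
      apply LinearMap.ext
      intro m
      exact (h.exact_zero y _).mpr ⟨m, rfl⟩
    exact exact_comp_iso _ _ θ _ (ind_map_exact X (P.d 1 0) ε h0 l s hl)
  -- In positive degrees two consecutive homotopies of the restricted resolution suffice; `θ` enters
  -- only at the augmented end.
  · obtain ⟨k, l, hkl⟩ := exists_slice_homotopy X h n
    exact ind_map_exact X (P.d (n + 2) (n + 1)) (P.d (n + 1) n) (P.d_comp_d _ _ _) l k hkl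

end

end HeckeInd

/-- The resolution property holds for every isomorphism out of the induced constant module, so `θ`
can be the degree isomorphism. -/
theorem mainTheorem6 {G R : Type u} [Group G] [CommRing R] (F : HeckeInd.FiniteFamily G) :
    ∃ θ : (HeckeInd.ind R (HeckeInd.sigma F ⋙ HeckeInd.pi R F)).obj
          (HeckeInd.constantModule R F) ≅
        HeckeInd.fixedPointModule F (Rep.trivial R G R),
      ∀ (P : ChainComplex (HeckeInd.AddMod R (HeckeInd.OrbitCat F)) ℕ)
        (ε : P.X 0 ⟶ HeckeInd.constantModule R F),
        HeckeInd.IsProjectiveResolution P ε →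
          HeckeInd.IsProjectiveResolution
            (((HeckeInd.ind R (HeckeInd.sigma F ⋙ HeckeInd.pi R F)).mapHomologicalComplex
              (ComplexShape.down ℕ)).obj P)
            ((HeckeInd.ind R (HeckeInd.sigma F ⋙ HeckeInd.pi R F)).map ε ≫ θ.hom) :=
  ⟨HeckeInd.indConstantIso F R, fun _ _ h => HeckeInd.isProjectiveResolution_ind h _⟩
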